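/- Let $a,d,e\in\mathbb R$ with $d<0$ be such that $P_6(x,y)=xy^2+ay-dx-e$ is irreducible in $\mathbb R[x,y]$, let $C=\mathcal Z(P_6)\subseteq\mathbb R^2$ be its real zero set, $I$ the vanishing ideal of $C$, $\mathbb R[C]=\mathbb R[x,y]/I$ with total ring of fractions $Q(\mathbb R[C])$, and for $m\ge 0$ let $\mathbb R[x,y]_{\le m}$ be the space of polynomials of total degree at most $m$, $I_{\le m}=I\cap\mathbb R[x,y]_{\le m}$, and $\mathbb R[C]_{\le m}$ the image of $\mathbb R[x,y]_{\le m}$ in $\mathbb R[C]$. Let $k\ge 1$ be an integer and put, in $\mathbb R[C]$, $$\mathcal B_k=\{x^k,x^{k-1},x^{k-1}y,\dots,x,xy,1,y,\dots,y^k\},\qquad \widetilde{\mathcal B}_k=\{x^ky,x^{k-1},x^{k-1}y,\dots,x,xy,1,y,\dots,y^k\},$$ $$V^{(k)}=\operatorname{Lin}\widetilde{\mathcal B}_k\subseteq Q(\mathbb R[C]),\qquad U=\operatorname{Lin}(\mathcal B_k\setminus\{y^k\}),\qquad W=\operatorname{Lin}(\widetilde{\mathcal B}_k\setminus\{y^k\}).$$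 (One has $gh\in\mathbb R[C]_{\le 2k}$ for all $g,h\in V^{(k)}$.) Let $L:\mathbb R[x,y]_{\le 2k}\to\mathbb R$ be a linear functional, and let $\overline L(f,g)=L(fg)$ on $\mathbb R[x,y]_{\le k}$. If $L$ vanishes on $I_{\le 2k}$, let $L_C:\mathbb R[C]_{\le 2k}\to\mathbb R$ be the induced functional, and define the bilinear forms $\overline L_C(f,g)=L_C(fg)$ on $\mathbb R[C]_{\le k}$ and $\overline L_{C,V^{(k)},1}(g,h)=L_C(gh)$ on $V^{(k)}$. Suppose that $L$ is $C$-singular, that is, $L$ vanishes on $I_{\le 2k}$, and $\ker\overline L\ne I_{\le k}$ or $\ker\overline L_{C,V^{(k)},1}\ne\{0\}$. Then the following are equivalent: 1. $L$ is a $C$-moment functional, that is, there is a (positive) Borel measure $\mu$ supported on $C$ such that every $f\in\mathbb R[x,y]_{\le 2k}$ is $\mu$-integrable and $L(f)=\int_C f\,d\mu$. 2. $L_C$ is square positive ($L_C(f^2)\ge 0$ for all $f\in\mathbb R[C]_{\le k}$) and $(V^{(k)},1)$-locally square positive ($L_C(g^2)\ge 0$ for all $g\in V^{(k)}$), and at least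 one of the following holds: (a) $\operatorname{rank}\overline L_C=\operatorname{rank}\big(\overline L_C|_U\big)$; (b) $\operatorname{rank}\overline L_{C,V^{(k)},1}=\operatorname{rank}\big(\overline L_{C,V^{(k)},1}|_W\big)$. -/

import Mathlib

open MvPolynomial MeasureTheory

noncomputable section

namespace CubicTMP

/-- The space `ℝ[x,y]_{≤ m}` of bivariate polynomials of total degree at most `m`
(`x = X 0`, `y = X 1`). -/
abbrev PolyLE (m : ℕ) : Submodule ℝ (MvPolynomial (Fin 2) ℝ) :=
  restrictTotalDegree (Fin 2) ℝ m

/-- The real zero set `𝒵(P) ⊆ ℝ²`. -/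
def zeroSet (P : MvPolynomial (Fin 2) ℝ) : Set (Fin 2 → ℝ) :=
  {v | eval v P = 0}

/-- `L` is a `K`-moment functional: it is integration against a (positive) Borel measure
supported on `K`. -/
def IsMomentFunctional (K : Set (Fin 2 → ℝ)) {m : ℕ} (L : PolyLE m →ₗ[ℝ] ℝ) : Prop :=
  ∃ μ : Measure (Fin 2 → ℝ), μ Kᶜ = 0 ∧
    ∀ f : PolyLE m, Integrable (fun v => eval v (f : MvPolynomial (Fin 2) ℝ)) μ ∧
      L f = ∫ v in K, eval v (f : MvPolynomial (Fin 2) ℝ) ∂μ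

/-- The ring `ℝ[C] = ℝ[x,y] / I` of polynomial functions on `C`, where `I` is the vanishing ideal
of `C`. -/
abbrev CoordRing (C : Set (Fin 2 → ℝ)) : Type :=
  MvPolynomial (Fin 2) ℝ ⧸ vanishingIdeal ℝ C

/-- The restriction map `ℝ[x,y] → ℝ[C]`. -/
abbrev restr (C : Set (Fin 2 → ℝ)) : MvPolynomial (Fin 2) ℝ →ₐ[ℝ] CoordRing C :=
  Ideal.Quotient.mkₐ ℝ (vanishingIdeal ℝ C)

/-- `ℝ[C]_{≤ m}`, the image of `ℝ[x,y]_{≤ m}` in `ℝ[C]`. -/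
def CoordLE (C : Set (Fin 2 → ℝ)) (m : ℕ) : Submodule ℝ (CoordRing C) :=
  (PolyLE m).map (restr C).toLinearMap

/-- The total ring of fractions `Q(ℝ[C])`. -/
abbrev TotalFrac (C : Set (Fin 2 → ℝ)) : Type := FractionRing (CoordRing C)

/-- The embedding `ℝ[C] ⊆ Q(ℝ[C])`, as a linear map. -/
abbrev toFrac (C : Set (Fin 2 → ℝ)) : CoordRing C →ₗ[ℝ] TotalFrac C :=
  (IsScalarTower.toAlgHom ℝ (CoordRing C) (TotalFrac C)).toLinearMap

theorem toFrac_injective (C : Set (Fin 2 → ℝ)) : Function.Injective (toFrac C) :=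
  IsFractionRing.injective (CoordRing C) (TotalFrac C)

theorem restr_mem {C : Set (Fin 2 → ℝ)} {m : ℕ} {p : MvPolynomial (Fin 2) ℝ}
    (hp : p ∈ PolyLE m) : restr C p ∈ CoordLE C m :=
  Submodule.mem_map_of_mem hp

theorem polyLE_mul_mem {k : ℕ} {p q : MvPolynomial (Fin 2) ℝ}
    (hp : p ∈ PolyLE k) (hq : q ∈ PolyLE k) : p * q ∈ PolyLE (2 * k) := by
  rw [mem_restrictTotalDegree] at *
  exact (totalDegree_mul p q).trans (by omega)

theorem coordLE_mul_mem {C : Set (Fin 2 → ℝ)} {k : ℕ} {f g : CoordRing C}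
    (hf : f ∈ CoordLE C k) (hg : g ∈ CoordLE C k) : f * g ∈ CoordLE C (2 * k) := by
  obtain ⟨p, hp, rfl⟩ := hf
  obtain ⟨q, hq, rfl⟩ := hg
  exact ⟨p * q, polyLE_mul_mem hp hq, map_mul (restr C) p q⟩

/-- The bilinear form `L̄(f,g) = L(fg)` on `ℝ[x,y]_{≤ k}`. -/
def polyForm {k : ℕ} (L : PolyLE (2 * k) →ₗ[ℝ] ℝ) : LinearMap.BilinForm ℝ (PolyLE k) :=
  LinearMap.mk₂ ℝ (fun f g => L ⟨(f : MvPolynomial (Fin 2) ℝ) * g, polyLE_mul_mem f.2 g.2⟩)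
    (fun f₁ f₂ g => by rw [← map_add]; congr 1; ext1; simp [add_mul])
    (fun c f g => by rw [← map_smul]; congr 1; ext1; simp)
    (fun f g₁ g₂ => by rw [← map_add]; congr 1; ext1; simp [mul_add])
    (fun c f g => by rw [← map_smul]; congr 1; ext1; simp)

/-- `L_C` is well defined: `L` vanishes on `I_{≤ m}`. -/
def Descends (C : Set (Fin 2 → ℝ)) {m : ℕ} (L : PolyLE m →ₗ[ℝ] ℝ) : Prop :=
  ∀ p : PolyLE m, (p : MvPolynomial (Fin 2) ℝ) ∈ vanishingIdeal ℝ C → L p = 0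

theorem Descends.eq_of_restr_eq {C : Set (Fin 2 → ℝ)} {m : ℕ} {L : PolyLE m →ₗ[ℝ] ℝ}
    (h : Descends C L) {p q : PolyLE m}
    (hpq : restr C (p : MvPolynomial (Fin 2) ℝ) = restr C (q : MvPolynomial (Fin 2) ℝ)) :
    L p = L q := by
  rw [← sub_eq_zero, ← map_sub]
  exact h _ (Ideal.Quotient.eq.mp hpq)

/-- A representative in `ℝ[x,y]_{≤ m}` of an element of `ℝ[C]_{≤ m}`. -/
def lift {C : Set (Fin 2 → ℝ)} {m : ℕ} (f : CoordLE C m) : PolyLE m :=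
  ⟨f.2.choose, f.2.choose_spec.1⟩

theorem restr_lift {C : Set (Fin 2 → ℝ)} {m : ℕ} (f : CoordLE C m) :
    restr C (lift f : MvPolynomial (Fin 2) ℝ) = (f : CoordRing C) :=
  f.2.choose_spec.2

/-- The induced functional `L_C : ℝ[C]_{≤ m} → ℝ`, `L_C(f + I) = L(f)`. -/
def induced {C : Set (Fin 2 → ℝ)} {m : ℕ} (L : PolyLE m →ₗ[ℝ] ℝ) (h : Descends C L) :
    CoordLE C m →ₗ[ℝ] ℝ where
  toFun f := L (lift f)
  map_add' f g := by
    rw [← map_add]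
    apply h.eq_of_restr_eq
    rw [restr_lift, Submodule.coe_add, Submodule.coe_add, map_add, restr_lift, restr_lift]
  map_smul' c f := by
    rw [RingHom.id_apply, ← map_smul]
    apply h.eq_of_restr_eq
    rw [restr_lift, Submodule.coe_smul, Submodule.coe_smul, map_smul, restr_lift]

theorem induced_apply {C : Set (Fin 2 → ℝ)} {m : ℕ} (L : PolyLE m →ₗ[ℝ] ℝ) (h : Descends C L)
    (p : PolyLE m) : induced L h ⟨restr C p, restr_mem p.2⟩ = L p :=
  h.eq_of_restr_eq (restr_lift _)

/-- The bilinear form `L̄_C(f,g) = L_C(fg)` on `ℝ[C]_{≤ k}`. -/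
def coordForm {C : Set (Fin 2 → ℝ)} {k : ℕ} (LC : CoordLE C (2 * k) →ₗ[ℝ] ℝ) :
    LinearMap.BilinForm ℝ (CoordLE C k) :=
  LinearMap.mk₂ ℝ (fun f g => LC ⟨(f : CoordRing C) * g, coordLE_mul_mem f.2 g.2⟩)
    (fun f₁ f₂ g => by rw [← map_add]; congr 1; ext1; simp [add_mul])
    (fun c f g => by rw [← map_smul]; congr 1; ext1; exact smul_mul_assoc c _ _)
    (fun f g₁ g₂ => by rw [← map_add]; congr 1; ext1; simp [mul_add])
    (fun c f g => by rw [← map_smul]; congr 1; ext1; exact mul_smul_comm c _ _)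

/-- The condition `f g h ∈ ℝ[C]_{≤ 2k}` for all `g, h ∈ V`, under which the localizing form of
the pair `(V, f)` makes sense. -/
def Admissible {C : Set (Fin 2 → ℝ)} (k : ℕ) (V : Submodule ℝ (TotalFrac C))
    (f : TotalFrac C) : Prop :=
  ∀ g ∈ V, ∀ h ∈ V, f * (g * h) ∈ (CoordLE C (2 * k)).map (toFrac C)

/-- The localizing form `L̄_{C,V,f}(g,h) = L_C(f g h)` on `V ⊆ Q(ℝ[C])`. -/
def locForm {C : Set (Fin 2 → ℝ)} {k : ℕ} (LC : CoordLE C (2 * k) →ₗ[ℝ] ℝ)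
    {V : Submodule ℝ (TotalFrac C)} {f : TotalFrac C} (hV : Admissible k V f) :
    LinearMap.BilinForm ℝ V :=
  LinearMap.mk₂ ℝ
    (fun g h => LC (((CoordLE C (2 * k)).equivMapOfInjective (toFrac C) (toFrac_injective C)).symm
      ⟨f * ((g : TotalFrac C) * h), hV g g.2 h h.2⟩))
    (fun g₁ g₂ h => by
      rw [← map_add, ← map_add]; congr 2; ext1; simp [add_mul, mul_add])
    (fun c g h => by rw [← map_smul, ← map_smul]; congr 2; ext1; simp)
    (fun g h₁ h₂ => by rw [← map_add, ← map_add]; congr 2; ext1; simp [mul_add])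
    (fun c g h => by rw [← map_smul, ← map_smul]; congr 2; ext1; simp)

theorem locForm_apply {C : Set (Fin 2 → ℝ)} {k : ℕ} (LC : CoordLE C (2 * k) →ₗ[ℝ] ℝ)
    {V : Submodule ℝ (TotalFrac C)} {f : TotalFrac C} (hV : Admissible k V f) (g h : V)
    (r : CoordLE C (2 * k)) (hr : toFrac C r = f * ((g : TotalFrac C) * h)) :
    locForm LC hV g h = LC r := by
  change LC _ = LC r
  congr 1
  rw [LinearEquiv.symm_apply_eq]
  ext1
  exact hr.symm

/-- `L_C(f²) ≥ 0` for all `f ∈ ℝ[C]_{≤ k}`. -/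
def SquarePositive {C : Set (Fin 2 → ℝ)} {k : ℕ} (LC : CoordLE C (2 * k) →ₗ[ℝ] ℝ) : Prop :=
  ∀ f : CoordLE C k, 0 ≤ coordForm LC f f

/-- `L_C(f g²) ≥ 0` for all `g ∈ V`. -/
def LocSquarePositive {C : Set (Fin 2 → ℝ)} {k : ℕ} (LC : CoordLE C (2 * k) →ₗ[ℝ] ℝ)
    {V : Submodule ℝ (TotalFrac C)} {f : TotalFrac C} (hV : Admissible k V f) : Prop :=
  ∀ g : V, 0 ≤ locForm LC hV g g

/-- `L` is `C`-nonsingular with respect to the pair `(V, f)`: `ker L̄ = I_{≤ k}` and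
`ker L̄_{C,V,f} = {0}`. -/
def Nonsingular {C : Set (Fin 2 → ℝ)} {k : ℕ} (L : PolyLE (2 * k) →ₗ[ℝ] ℝ) (h : Descends C L)
    {V : Submodule ℝ (TotalFrac C)} {f : TotalFrac C} (hV : Admissible k V f) : Prop :=
  (∀ p : PolyLE k, p ∈ LinearMap.ker (polyForm L) ↔
      (p : MvPolynomial (Fin 2) ℝ) ∈ vanishingIdeal ℝ C) ∧
    LinearMap.ker (locForm (induced L h) hV) = ⊥

/-- `L` is `C`-singular with respect to `(V, f)`: `L_C` is well defined, but `L` is not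
`C`-nonsingular. -/
def Singular {C : Set (Fin 2 → ℝ)} {k : ℕ} (L : PolyLE (2 * k) →ₗ[ℝ] ℝ)
    {V : Submodule ℝ (TotalFrac C)} {f : TotalFrac C} (hV : Admissible k V f) : Prop :=
  ∃ h : Descends C L, ¬ Nonsingular L h hV

theorem Singular.descends {C : Set (Fin 2 → ℝ)} {k : ℕ} {L : PolyLE (2 * k) →ₗ[ℝ] ℝ}
    {V : Submodule ℝ (TotalFrac C)} {f : TotalFrac C} {hV : Admissible k V f}
    (h : Singular L hV) : Descends C L :=
  h.1

/-- The rank of the restriction `B|_U` of a bilinear form on `V` to `V ∩ U`; below always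
`U ⊆ V`. -/
def rankOn {E : Type} [AddCommGroup E] [Module ℝ E] {V : Submodule ℝ E}
    (B : LinearMap.BilinForm ℝ V) (U : Submodule ℝ E) : Cardinal :=
  LinearMap.rank (B.restrict (U.submoduleOf V))

/-- `P₆ = x y² + a y - d x - e`. -/
def P6 (a d e : ℝ) : MvPolynomial (Fin 2) ℝ :=
  X 0 * X 1 ^ 2 + C a * X 1 - C d * X 0 - C e

/-- The curve `𝒵(P₆)`. -/
abbrev curve6 (a d e : ℝ) : Set (Fin 2 → ℝ) := zeroSet (P6 a d e)

/-- The monomial `xⁱ yʲ` in `ℝ[C]`. -/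
def mon (C : Set (Fin 2 → ℝ)) (i j : ℕ) : CoordRing C :=
  restr C (X 0 ^ i * X 1 ^ j)

/-- `{x^{k-1}, x^{k-1}y, …, x, xy, 1, y, …, y^k} ⊆ ℝ[C]`. -/
def basisCore (C : Set (Fin 2 → ℝ)) (k : ℕ) : Set (CoordRing C) :=
  {b | ∃ i, 1 ≤ i ∧ i ≤ k - 1 ∧ (b = mon C i 0 ∨ b = mon C i 1)} ∪ {b | ∃ j ≤ k, b = mon C 0 j}

/-- `ℬ_k = {x^k, x^{k-1}, x^{k-1}y, …, x, xy, 1, y, …, y^k}`. -/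
def basisB (C : Set (Fin 2 → ℝ)) (k : ℕ) : Set (CoordRing C) :=
  {mon C k 0} ∪ basisCore C k

/-- `ℬ̃_k = {x^k y, x^{k-1}, x^{k-1}y, …, x, xy, 1, y, …, y^k}`, that is, `ℬ_k` with `x^k`
replaced by `x^k y`. -/
def basisBt (C : Set (Fin 2 → ℝ)) (k : ℕ) : Set (CoordRing C) :=
  {mon C k 1} ∪ basisCore C k

/-- `V^{(k)} = Lin ℬ̃_k ⊆ Q(ℝ[C])`. -/
def Vk (C : Set (Fin 2 → ℝ)) (k : ℕ) : Submodule ℝ (TotalFrac C) :=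
  Submodule.span ℝ (toFrac C '' basisBt C k)

/-- `U = Lin (ℬ_k \ {y^k}) ⊆ ℝ[C]_{≤ k}`. -/
def Uk (C : Set (Fin 2 → ℝ)) (k : ℕ) : Submodule ℝ (CoordRing C) :=
  Submodule.span ℝ (basisB C k \ {mon C 0 k})

/-- `W = Lin (ℬ̃_k \ {y^k}) ⊆ V^{(k)}`. -/
def Wk (C : Set (Fin 2 → ℝ)) (k : ℕ) : Submodule ℝ (TotalFrac C) :=
  Submodule.span ℝ (toFrac C '' (basisBt C k \ {mon C 0 k}))

theorem mon_mul (C : Set (Fin 2 → ℝ)) (i j i' j' : ℕ) :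
    mon C i j * mon C i' j' = mon C (i + i') (j + j') := by
  unfold mon
  rw [← map_mul]
  congr 1
  ring

theorem mon_mem (C : Set (Fin 2 → ℝ)) {i j m : ℕ} (h : i + j ≤ m) : mon C i j ∈ CoordLE C m := by
  apply restr_mem
  rw [mem_restrictTotalDegree]
  refine (totalDegree_mul _ _).trans (le_trans (add_le_add (totalDegree_pow _ _)
    (totalDegree_pow _ _)) ?_)
  simpa using h

theorem mon_reduce (a d e : ℝ) (i j : ℕ) :
    mon (curve6 a d e) (i + 1) (j + 2) = (-a) • mon (curve6 a d e) i (j + 1)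
      + d • mon (curve6 a d e) (i + 1) j + e • mon (curve6 a d e) i j := by
  unfold mon
  rw [← map_smul, ← map_smul, ← map_smul, ← map_add, ← map_add]
  apply Ideal.Quotient.eq.mpr
  intro v hv
  have h0 : eval v (P6 a d e) = 0 := hv
  simp only [P6, map_sub, map_add, map_mul, map_pow, eval_X, eval_C] at h0
  simp only [map_sub, map_add, map_mul, map_pow, map_smul, aeval_X, smul_eq_mul]
  linear_combination (v 0 ^ i * v 1 ^ j) * h0

theorem mon_reduce_mem (a d e : ℝ) {i j m : ℕ} (hi : 1 ≤ i) (hj : 2 ≤ j) (h : i + j ≤ m + 2) :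
    mon (curve6 a d e) i j ∈ CoordLE (curve6 a d e) m := by
  obtain ⟨i, rfl⟩ := Nat.exists_eq_add_of_le' hi
  obtain ⟨j, rfl⟩ := Nat.exists_eq_add_of_le' hj
  rw [mon_reduce]
  exact add_mem (add_mem (Submodule.smul_mem _ _ (mon_mem _ (by omega)))
    (Submodule.smul_mem _ _ (mon_mem _ (by omega)))) (Submodule.smul_mem _ _ (mon_mem _ (by omega)))

theorem exists_mon_of_mem_basisBt {C : Set (Fin 2 → ℝ)} {k : ℕ} (hk : 1 ≤ k) {b : CoordRing C}
    (hb : b ∈ basisBt C k) :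
    ∃ i j, b = mon C i j ∧ ((i = k ∧ j = 1) ∨ (i + j ≤ k ∧ (j = 0 → i < k))) := by
  rcases hb with rfl | ⟨i, hi, hik, rfl | rfl⟩ | ⟨j, hj, rfl⟩
  · exact ⟨k, 1, rfl, by omega⟩
  · exact ⟨i, 0, rfl, by omega⟩
  · exact ⟨i, 1, rfl, by omega⟩
  · exact ⟨0, j, rfl, by omega⟩

/-- On `𝒵(P₆)` all products of two elements of `V^{(k)}` lie in `ℝ[C]_{≤ 2k}`. -/
theorem admissible_Vk (a d e : ℝ) {k : ℕ} (hk : 1 ≤ k) :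
    Admissible k (Vk (curve6 a d e) k) 1 := by
  have key : Submodule.span ℝ (basisBt (curve6 a d e) k) *
      Submodule.span ℝ (basisBt (curve6 a d e) k) ≤ CoordLE (curve6 a d e) (2 * k) := by
    rw [Submodule.span_mul_span, Submodule.span_le]
    rintro _ ⟨b, hb, c, hc, rfl⟩
    obtain ⟨i, j, rfl, h⟩ := exists_mon_of_mem_basisBt hk hb
    obtain ⟨i', j', rfl, h'⟩ := exists_mon_of_mem_basisBt hk hc
    simp only [mon_mul, SetLike.mem_coe]
    by_cases hle : i + i' + (j + j') ≤ 2 * k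
    · exact mon_mem _ hle
    · exact mon_reduce_mem a d e (by omega) (by omega) (by omega)
  intro g hg h hh
  rw [Vk, ← Submodule.map_span] at hg hh
  obtain ⟨g, hg, rfl⟩ := hg
  obtain ⟨h, hh, rfl⟩ := hh
  exact ⟨g * h, key (Submodule.mul_mem_mul hg hh), by simp⟩

theorem Uk_le (C : Set (Fin 2 → ℝ)) {k : ℕ} : Uk C k ≤ CoordLE C k := by
  refine Submodule.span_le.mpr ?_
  rintro b ⟨rfl | ⟨i, hi, hik, rfl | rfl⟩ | ⟨j, hj, rfl⟩, -⟩ <;> exact mon_mem C (by omega)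

theorem Wk_le (C : Set (Fin 2 → ℝ)) (k : ℕ) : Wk C k ≤ Vk C k :=
  Submodule.span_mono (Set.image_mono Set.sdiff_subset)

end CubicTMP

end

open CubicTMP

/-!
Since `d < 0`, the curve is the graph of `x = (e - a y) / (y² - d)` over the `y`-axis. A function in
`ℝ[C]_{≤ m}` becomes `q / (y² - d)ᵐ` with a polynomial `q` of degree at most `3m` whose value at the
pole `i√(-d)` is a real multiple of `ωᵐ`, where `ω = e - a i√(-d)` is nonzero because `P₆` is
irreducible. In the same way `Lin ℬ_k` and `Lin ℬ̃_k` correspond to the numerators of degree at most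
`3k` whose value at the pole is a real multiple of `ωᵏ`, respectively of `ωᵏ i√(-d)`.

If `f ∈ ℝ[C]_{≤ 2k}` is nonnegative on `C`, its numerator is a sum of two squares `p² + q²`. As its
value at the pole lies in `ℝ ω²ᵏ`, a rotation of `(p, q)` makes `p` the numerator of an element of
`Lin ℬ_k` and `q` that of an element of `Lin ℬ̃_k`. So square positivity and local square positivity
together make `L` nonnegative on nonnegative functions, and then `L` is integration of the
homogenized numerators against a measure on the circle, the point `y = ∞` included. That point
carries no mass as soon as `L_C(g²) = 0` for some `g` in one of the two spaces whose numerator has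
exact degree `3k`, that is, some `g` outside the hyperplane `U` or `W`; for a nonnegative form this
is what equality of the ranks means.

Conversely, if `L` is a singular moment functional, then `L_C(g²) = 0` for some `g ≠ 0` in one of
the two spaces. Multiplying the numerator of `g` by a power of `y` raises its degree to `3k`, keeps
it in one of the two spaces and keeps the zeros of `g`, on which the measure is concentrated.
-/

noncomputable section

namespace CubicTMP

theorem nonneg_of_mul_nonneg {p q : Polynomial ℝ} (hp0 : p ≠ 0) (hp : ∀ t, 0 ≤ p.eval t)
    (hpq : ∀ t, 0 ≤ (p * q).eval t) (t : ℝ) : 0 ≤ q.eval t := by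
  have hdense : Dense {t | p.eval t = 0}ᶜ :=
    (Polynomial.finite_setOfPred_isRoot hp0).countable.dense_compl ℝ
  have hclosed : IsClosed {t | 0 ≤ q.eval t} := isClosed_le continuous_const q.continuous
  refine hclosed.closure_subset_iff.2 (fun s hs => ?_) (hdense t)
  have hps : 0 < p.eval s := (hp s).lt_of_ne' hs
  exact nonneg_of_mul_nonneg_right (Polynomial.eval_mul (x := s) ▸ hpq s) hps

theorem X_sub_C_sq_dvd_of_nonneg {q : Polynomial ℝ} (hq : ∀ t, 0 ≤ q.eval t) {r : ℝ}
    (hr : q.IsRoot r) : (Polynomial.X - Polynomial.C r) ^ 2 ∣ q := by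
  obtain rfl | hq0 := eq_or_ne q 0
  · exact dvd_zero _
  have hmin : IsLocalMin (fun t => q.eval t) r :=
    Filter.Eventually.of_forall fun t => hr.le.trans (hq t)
  have hderiv : q.derivative.IsRoot r := q.deriv.symm.trans hmin.deriv_eq_zero
  exact (Polynomial.le_rootMultiplicity_iff hq0).1
    ((Polynomial.one_lt_rootMultiplicity_iff_isRoot hq0).2 ⟨hr, hderiv⟩)

theorem sq_add_sq_dvd_of_nonneg {q : Polynomial ℝ} (hq : ∀ t, 0 ≤ q.eval t) {z : ℂ}
    (hz : Polynomial.aeval z q = 0) :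
    (Polynomial.X - Polynomial.C z.re) ^ 2 + Polynomial.C z.im ^ 2 ∣ q := by
  by_cases him : z.im = 0
  · have hr : q.IsRoot z.re := by
      rw [← Complex.re_add_im z, him, Complex.ofReal_zero, zero_mul, add_zero,
        ← Complex.coe_algebraMap, Polynomial.aeval_algebraMap_apply] at hz
      simpa using hz
    simpa [him] using X_sub_C_sq_dvd_of_nonneg hq hr
  · convert q.quadratic_dvd_of_aeval_eq_zero_im_ne_zero hz him using 1
    rw [Complex.sq_norm, Complex.normSq_apply]
    simp only [map_mul, map_add, Polynomial.C_ofNat]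
    ring

theorem exists_eq_sq_add_sq_of_nonneg {q : Polynomial ℝ} (hq : ∀ t, 0 ≤ q.eval t) :
    ∃ f g : Polynomial ℝ, q = f ^ 2 + g ^ 2 := by
  induction hn : q.natDegree using Nat.strong_induction_on generalizing q with
  | _ n ih =>
  by_cases hn0 : q.natDegree = 0
  · obtain ⟨c, rfl⟩ := Polynomial.natDegree_eq_zero.1 hn0
    have hc : 0 ≤ c := by simpa using hq 0
    exact ⟨Polynomial.C √c, 0, by simp [← Polynomial.C_pow, Real.sq_sqrt hc]⟩
  obtain ⟨z, hz⟩ := IsAlgClosed.exists_aeval_eq_zero ℂ q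
    fun h => hn0 (Polynomial.natDegree_eq_of_degree_eq_some h)
  set p : Polynomial ℝ := (Polynomial.X - Polynomial.C z.re) ^ 2 + Polynomial.C z.im ^ 2
  have hpmonic : p.Monic := by unfold p; monicity!
  have hpdeg : p.natDegree = 2 := by unfold p; compute_degree!
  have hpos : ∀ t, 0 ≤ p.eval t := by
    intro t
    simp only [p, Polynomial.eval_add, Polynomial.eval_pow]
    positivity
  obtain ⟨q', rfl⟩ : p ∣ q := sq_add_sq_dvd_of_nonneg hq hz
  have hq' : q' ≠ 0 := by rintro rfl; simp at hn0
  have hdeg : (p * q').natDegree = 2 + q'.natDegree := by rw [hpmonic.natDegree_mul' hq', hpdeg]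
  obtain ⟨f, g, rfl⟩ := ih _ (by omega) (nonneg_of_mul_nonneg hpmonic.ne_zero hpos hq) rfl
  exact ⟨_, _, sq_add_sq_mul_sq_add_sq⟩

theorem natDegree_le_natDegree_sq_add_sq (f g : Polynomial ℝ) :
    2 * f.natDegree ≤ (f ^ 2 + g ^ 2).natDegree := by
  obtain rfl | hf := eq_or_ne f 0
  · simp
  have hlead : (f ^ 2).leadingCoeff + (g ^ 2).leadingCoeff ≠ 0 := by
    have := Polynomial.leadingCoeff_ne_zero.2 hf
    rw [Polynomial.leadingCoeff_pow, Polynomial.leadingCoeff_pow]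
    positivity
  rw [← Polynomial.natDegree_pow]
  apply Polynomial.natDegree_le_natDegree
  rw [Polynomial.degree_add_eq_of_leadingCoeff_add_ne_zero hlead]
  exact le_max_left _ _

theorem exists_sq_add_sq_eq_one_orthogonal (x y : ℝ) :
    ∃ c s : ℝ, c ^ 2 + s ^ 2 = 1 ∧ c * x + s * y = 0 := by
  refine ⟨Real.sin (Complex.arg ⟨x, y⟩), -Real.cos (Complex.arg ⟨x, y⟩), by simp, ?_⟩
  have hx := Complex.norm_mul_cos_arg ⟨x, y⟩
  have hy := Complex.norm_mul_sin_arg ⟨x, y⟩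
  dsimp only at hx hy
  linear_combination Real.cos (Complex.arg ⟨x, y⟩) * hy - Real.sin (Complex.arg ⟨x, y⟩) * hx

theorem exists_rotation_of_im_sq_add_sq_eq_zero {α β : ℂ} (h : (α ^ 2 + β ^ 2).im = 0) :
    ∃ c s : ℝ, c ^ 2 + s ^ 2 = 1 ∧ (c * α + s * β).im = 0 ∧ (c * β - s * α).re = 0 := by
  have horth : α.re * α.im + β.re * β.im = 0 := by
    simp only [pow_two, Complex.add_im, Complex.mul_im] at h
    linarith
  suffices ∃ c s : ℝ, c ^ 2 + s ^ 2 = 1 ∧ c * α.im + s * β.im = 0 ∧ c * β.re - s * α.re = 0 by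
    simpa using this
  by_cases hre : α.re = 0 ∧ β.re = 0
  · obtain ⟨c, s, hcs, him⟩ := exists_sq_add_sq_eq_one_orthogonal α.im β.im
    exact ⟨c, s, hcs, him, by simp [hre]⟩
  · obtain ⟨c, s, hcs, hre'⟩ := exists_sq_add_sq_eq_one_orthogonal β.re (-α.re)
    refine ⟨c, s, hcs, ?_, by linarith⟩
    rcases not_and_or.1 hre with hα | hβ
    · apply mul_left_cancel₀ hα
      linear_combination c * horth - β.im * hre'
    · apply mul_left_cancel₀ hβ
      linear_combination s * horth + α.im * hre'

theorem exists_eq_sq_add_sq_aeval_mem_span {q : Polynomial ℝ} (hq : ∀ t, 0 ≤ q.eval t) {z ω : ℂ}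
    (hω : ω ≠ 0) (hqω : Polynomial.aeval z q ∈ (ℝ ∙ ω ^ 2)) :
    ∃ f g : Polynomial ℝ, q = f ^ 2 + g ^ 2 ∧ Polynomial.aeval z f ∈ (ℝ ∙ ω) ∧
      Polynomial.aeval z g ∈ (ℝ ∙ ω * Complex.I) := by
  obtain ⟨f, g, rfl⟩ := exists_eq_sq_add_sq_of_nonneg hq
  obtain ⟨r, hr⟩ := Submodule.mem_span_singleton.1 hqω
  obtain ⟨α, hα⟩ : ∃ α, Polynomial.aeval z f = α * ω := ⟨_, (div_mul_cancel₀ _ hω).symm⟩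
  obtain ⟨β, hβ⟩ : ∃ β, Polynomial.aeval z g = β * ω := ⟨_, (div_mul_cancel₀ _ hω).symm⟩
  have hαβ : α ^ 2 + β ^ 2 = r := by
    apply mul_right_cancel₀ (pow_ne_zero 2 hω)
    rw [← Complex.real_smul, hr, map_add, map_pow, map_pow, hα, hβ]
    ring
  obtain ⟨c, s, hcs, him, hre⟩ := exists_rotation_of_im_sq_add_sq_eq_zero
    (hαβ ▸ Complex.ofReal_im r)
  refine ⟨c • f + s • g, c • g - s • f, ?_, ?_, ?_⟩
  · have hCcs : Polynomial.C c ^ 2 + Polynomial.C s ^ 2 = 1 := by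
      simp only [← Polynomial.C_pow, ← Polynomial.C_add, hcs, Polynomial.C_1]
    simp only [Polynomial.smul_eq_C_mul]
    linear_combination (-f ^ 2 - g ^ 2) * hCcs
  · refine Submodule.mem_span_singleton.2 ⟨(c * α + s * β).re, ?_⟩
    have hreal : ((c * α + s * β).re : ℂ) = c * α + s * β := Complex.ext rfl him.symm
    simp only [map_add, map_smul, hα, hβ, Complex.real_smul, hreal]
    ring
  · refine Submodule.mem_span_singleton.2 ⟨(c * β - s * α).im, ?_⟩
    have himag : ((c * β - s * α).im : ℂ) * Complex.I = c * β - s * α :=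
      Complex.ext (by simp [hre]) (by simp)
    simp only [map_sub, map_smul, hα, hβ, Complex.real_smul]
    linear_combination ω * himag

section RieszHaviland

variable {X M : Type*} [TopologicalSpace X] [CompactSpace X] [AddCommGroup M] [Module ℝ M]

theorem exists_measure_of_nonneg [T2Space X] [MeasurableSpace X] [BorelSpace X]
    (G : C(X, ℝ) →ₗ[ℝ] ℝ) (hG : ∀ φ, 0 ≤ φ → 0 ≤ G φ) :
    ∃ ν : Measure X, IsFiniteMeasure ν ∧ ∀ φ, G φ = ∫ x, φ x ∂ν := by
  let P : CompactlySupportedContinuousMap X ℝ →ₗ[ℝ] ℝ :=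
    { toFun := fun φ => G φ.toContinuousMap
      map_add' := fun φ ψ => map_add G φ.toContinuousMap ψ.toContinuousMap
      map_smul' := fun c φ => map_smul G c φ.toContinuousMap }
  let Q : CompactlySupportedContinuousMap X ℝ →ₚ[ℝ] ℝ :=
    PositiveLinearMap.mk₀ P fun φ hφ => hG φ.toContinuousMap hφ
  exact ⟨RealRMK.rieszMeasure Q, inferInstance, fun φ => (RealRMK.integral_rieszMeasure Q
    (CompactlySupportedContinuousMap.continuousMapEquiv φ)).symm⟩

theorem exists_pos_forall_le_of_forall_pos {φ : C(X, ℝ)} (hφ : ∀ x, 0 < φ x) :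
    ∃ δ > 0, ∀ x, δ ≤ φ x := by
  rcases isEmpty_or_nonempty X with hX | hX
  · exact ⟨1, one_pos, fun x => hX.elim x⟩
  · obtain ⟨x₀, -, hx₀⟩ := isCompact_univ.exists_isMinOn Set.univ_nonempty φ.continuous.continuousOn
    exact ⟨φ x₀, hφ x₀, fun x => hx₀ (Set.mem_univ x)⟩

theorem exists_nonneg_extension (T : M →ₗ[ℝ] C(X, ℝ)) (Λ : M →ₗ[ℝ] ℝ)
    (hΛ : ∀ m, 0 ≤ T m → 0 ≤ Λ m) {u : M} (hu : ∀ x, 0 < T u x) :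
    ∃ G : C(X, ℝ) →ₗ[ℝ] ℝ, (∀ φ, 0 ≤ φ → 0 ≤ G φ) ∧ ∀ m, G (T m) = Λ m := by
  have hker : LinearMap.ker T ≤ LinearMap.ker Λ := fun m (hm : T m = 0) => by
    have hneg : 0 ≤ Λ (-m) := hΛ (-m) (by simp [hm])
    exact le_antisymm (by simpa using hneg) (hΛ m hm.ge)
  obtain ⟨σ, hσ⟩ := T.rangeRestrict.exists_rightInverse_of_surjective T.range_rangeRestrict
  have hσT : ∀ y, T (σ y) = y := fun y => congrArg Subtype.val (LinearMap.congr_fun hσ y)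
  let f : C(X, ℝ) →ₗ.[ℝ] ℝ := ⟨LinearMap.range T, Λ ∘ₗ σ⟩
  obtain ⟨δ, hδ, hδu⟩ := exists_pos_forall_le_of_forall_pos hu
  have hcofinal : ∀ φ : C(X, ℝ), ∃ y : f.domain, (y : C(X, ℝ)) + φ ∈ PointedCone.positive ℝ _ := by
    intro φ
    refine ⟨⟨T ((‖φ‖ / δ) • u), LinearMap.mem_range_self T _⟩, fun x => ?_⟩
    have hnorm : -φ x ≤ ‖φ‖ := neg_le.1 (abs_le.1 (φ.norm_coe_le_norm x)).1
    have hbound : ‖φ‖ ≤ ‖φ‖ / δ * T u x := by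
      rw [div_mul_eq_mul_div, le_div_iff₀ hδ]
      exact mul_le_mul_of_nonneg_left (hδu x) (norm_nonneg φ)
    change 0 ≤ T ((‖φ‖ / δ) • u) x + φ x
    rw [map_smul, ContinuousMap.smul_apply, smul_eq_mul]
    linarith
  obtain ⟨G, hGf, hG⟩ := riesz_extension (PointedCone.positive ℝ C(X, ℝ)) f
    (fun y hy => hΛ (σ y) (by rwa [hσT])) hcofinal
  refine ⟨G, hG, fun m => ?_⟩
  have hm : σ ⟨T m, m, rfl⟩ - m ∈ LinearMap.ker T := by simp [hσT]
  rw [← sub_eq_zero.1 ((map_sub Λ _ _).symm.trans (hker hm))]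
  exact hGf ⟨T m, m, rfl⟩

theorem exists_measure_of_nonneg_on_nonneg [T2Space X] [MeasurableSpace X] [BorelSpace X]
    (T : M →ₗ[ℝ] C(X, ℝ)) (Λ : M →ₗ[ℝ] ℝ) (hΛ : ∀ m, 0 ≤ T m → 0 ≤ Λ m) {u : M}
    (hu : ∀ x, 0 < T u x) :
    ∃ ν : Measure X, IsFiniteMeasure ν ∧ ∀ m, Λ m = ∫ x, T m x ∂ν := by
  obtain ⟨G, hG, hGT⟩ := exists_nonneg_extension T Λ hΛ hu
  obtain ⟨ν, hν, hGν⟩ := exists_measure_of_nonneg G hG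
  exact ⟨ν, hν, fun m => (hGT m).symm.trans (hGν (T m))⟩

end RieszHaviland

section Submodule

variable {R M : Type*} [AddCommGroup M]

theorem isCoatom_submoduleOf_of_covBy [Ring R] [Module R M] {U V : Submodule R M} (h : U ⋖ V) :
    IsCoatom (U.submoduleOf V) := by
  rw [← V.mapIic.isCoatom_iff, Set.Iic.isCoatom_iff]
  convert h using 1
  exact (Submodule.map_comap_subtype V U).trans (inf_eq_right.2 h.le)

theorem span_sdiff_covBy_span [DivisionRing R] [Module R M] {s : Set M} {b : M}
    (hbs : b ∈ s) (hb : b ∉ Submodule.span R (s \ {b})) :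
    Submodule.span R (s \ {b}) ⋖ Submodule.span R s := by
  conv_rhs => rw [← Set.insert_sdiff_self_of_mem hbs, Submodule.span_insert]
  exact Submodule.covBy_span_singleton_sup hb

end Submodule

section BilinForm

variable {R K M : Type*} [AddCommGroup M]

theorem rank_restrict_lt_of_ker_le [Field K] [Module K M] [FiniteDimensional K M]
    {B : LinearMap.BilinForm K M} {S : Submodule K M} (hS : S ≠ ⊤)
    (hker : LinearMap.ker B ≤ S) : LinearMap.rank (B.restrict S) < LinearMap.rank B := by
  have hcomap : (LinearMap.ker B).submoduleOf S ≤ LinearMap.ker (B.restrict S) := fun x hx => by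
    ext y
    exact LinearMap.congr_fun hx (y : M)
  have hle := Submodule.finrank_mono hcomap
  rw [(Submodule.submoduleOfEquivOfLe hker).finrank_eq] at hle
  have hrank := LinearMap.finrank_range_add_finrank_ker B
  have hrankS := LinearMap.finrank_range_add_finrank_ker (B.restrict S)
  have hlt := Submodule.finrank_lt hS
  unfold LinearMap.rank
  rw [← Module.finrank_eq_rank, ← Module.finrank_eq_rank, Nat.cast_lt]
  omega

theorem rank_restrict_eq_of_sup_eq_top [CommRing R] [Module R M]
    {B : LinearMap.BilinForm R M} (hB : B.IsSymm) {S : Submodule R M}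
    (hS : S ⊔ LinearMap.ker B = ⊤) : LinearMap.rank (B.restrict S) = LinearMap.rank B := by
  have hrange : LinearMap.range (B.domRestrict S) = LinearMap.range B := by
    rw [LinearMap.range_domRestrict, LinearMap.range_eq_map, ← hS, Submodule.map_sup,
      LinearMap.le_ker_iff_map.1 (le_refl (LinearMap.ker B)), sup_bot_eq]
  have hker : LinearMap.ker (B.domRestrict S) = LinearMap.ker (B.restrict S) := by
    refine le_antisymm (fun x hx => ?_) (fun x hx => ?_)
    · ext y
      exact LinearMap.congr_fun hx (y : M)
    · ext z
      obtain ⟨y, hy, w, hw, rfl⟩ := Submodule.mem_sup.1 (hS ▸ Submodule.mem_top : z ∈ _)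
      have hxy : B x y = 0 := LinearMap.congr_fun hx ⟨y, hy⟩
      have hxw : B x w = 0 := by rw [hB.eq, LinearMap.mem_ker.1 hw, LinearMap.zero_apply]
      simp [hxy, hxw]
  unfold LinearMap.rank
  rw [← hrange]
  exact ((LinearMap.quotKerEquivRange (B.restrict S)).symm.trans <|
    (Submodule.quotEquivOfEq _ _ hker.symm).trans <|
    LinearMap.quotKerEquivRange (B.domRestrict S)).rank_eq

end BilinForm

section NonnegBilinForm

variable {M : Type*} [AddCommGroup M] [Module ℝ M]

theorem mem_ker_iff_of_nonneg {B : LinearMap.BilinForm ℝ M} (hB : B.IsSymm)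
    (hB0 : ∀ x, 0 ≤ B x x) {g : M} : g ∈ LinearMap.ker B ↔ B g g = 0 := by
  refine ⟨fun hg => by rw [LinearMap.mem_ker.1 hg, LinearMap.zero_apply], fun hg => ?_⟩
  ext y
  have hcs : B g y ^ 2 ≤ B g g * B y y := B.apply_sq_le_of_symm hB0 ⟨hB.eq⟩ g y
  rw [hg, zero_mul] at hcs
  exact pow_eq_zero_iff two_ne_zero |>.1 (hcs.antisymm (sq_nonneg _))

theorem rank_eq_rank_restrict_iff [FiniteDimensional ℝ M]
    {B : LinearMap.BilinForm ℝ M} (hB : B.IsSymm) (hB0 : ∀ x, 0 ≤ B x x)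
    {S : Submodule ℝ M} (hS : IsCoatom S) :
    LinearMap.rank B = LinearMap.rank (B.restrict S) ↔ ∃ g ∉ S, B g g = 0 := by
  constructor
  · intro hrank
    obtain ⟨g, hg, hgS⟩ := SetLike.not_le_iff_exists.1 fun hle =>
      (rank_restrict_lt_of_ker_le hS.1 hle).ne' hrank
    exact ⟨g, hgS, (mem_ker_iff_of_nonneg hB hB0).1 hg⟩
  · rintro ⟨g, hgS, hg⟩
    have hker : ¬ LinearMap.ker B ≤ S := fun hle =>
      hgS (hle ((mem_ker_iff_of_nonneg hB hB0).2 hg))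
    refine (rank_restrict_eq_of_sup_eq_top hB (hS.2 _ ?_)).symm
    exact left_lt_sup.2 hker

theorem rank_eq_rankOn_iff {E : Type} [AddCommGroup E] [Module ℝ E] {U V : Submodule ℝ E}
    [FiniteDimensional ℝ V] {B : LinearMap.BilinForm ℝ V} (hB : B.IsSymm) (hB0 : ∀ x, 0 ≤ B x x)
    (hUV : U ⋖ V) : LinearMap.rank B = rankOn B U ↔ ∃ g : V, (g : E) ∉ U ∧ B g g = 0 :=
  rank_eq_rank_restrict_iff hB hB0 (isCoatom_submoduleOf_of_covBy hUV)

end NonnegBilinForm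

/-- The value at a point `v` of `C` of the polynomial functions on `C`. -/
def evalAt {C : Set (Fin 2 → ℝ)} (v : Fin 2 → ℝ) (hv : v ∈ C) : CoordRing C →ₐ[ℝ] ℝ :=
  Ideal.Quotient.liftₐ (vanishingIdeal ℝ C) (MvPolynomial.aeval v) fun _ hp => hp v hv

theorem evalAt_restr {C : Set (Fin 2 → ℝ)} {v : Fin 2 → ℝ} (hv : v ∈ C)
    (p : MvPolynomial (Fin 2) ℝ) : evalAt v hv (restr C p) = eval v p := by
  change MvPolynomial.aeval v p = _
  rw [MvPolynomial.aeval_eq_eval]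

theorem evalAt_mon {C : Set (Fin 2 → ℝ)} {v : Fin 2 → ℝ} (hv : v ∈ C) (i j : ℕ) :
    evalAt v hv (mon C i j) = v 0 ^ i * v 1 ^ j := by
  rw [mon, evalAt_restr]
  simp

theorem eq_of_evalAt_eq {C : Set (Fin 2 → ℝ)} {f g : CoordRing C}
    (h : ∀ v (hv : v ∈ C), evalAt v hv f = evalAt v hv g) : f = g := by
  rw [← sub_eq_zero]
  obtain ⟨p, hp⟩ := Ideal.Quotient.mkₐ_surjective ℝ (vanishingIdeal ℝ C) (f - g)
  rw [← hp]
  refine Ideal.Quotient.eq_zero_iff_mem.2 fun v hv => ?_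
  rw [MvPolynomial.aeval_eq_eval, ← evalAt_restr hv, hp, map_sub, h, sub_self]

variable {a d e : ℝ} {k : ℕ} {ε : Fin 2}

section Parametrization

/-- The rational parametrization of `𝒵(P₆)` by the `y`-coordinate. -/
def param (a d e t : ℝ) : Fin 2 → ℝ := ![(e - a * t) / (t ^ 2 - d), t]

theorem mem_curve6_iff {v : Fin 2 → ℝ} :
    v ∈ curve6 a d e ↔ v 0 * (v 1 ^ 2 - d) = e - a * v 1 := by
  have h : eval v (P6 a d e) = v 0 * (v 1 ^ 2 - d) - (e - a * v 1) := by
    simp only [P6, map_sub, map_add, map_mul, map_pow, eval_X, eval_C]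
    ring
  rw [← sub_eq_zero, ← h]
  rfl

theorem sq_sub_pos (hd : d < 0) (t : ℝ) : 0 < t ^ 2 - d := by
  linarith [sq_nonneg t]

theorem param_mem_curve6 (hd : d < 0) (t : ℝ) : param a d e t ∈ curve6 a d e :=
  mem_curve6_iff.2 (div_mul_cancel₀ _ (sq_sub_pos hd t).ne')

/-- The denominator `y² - d` of the parametrization. -/
def paramDenom (d : ℝ) : Polynomial ℝ := Polynomial.X ^ 2 - Polynomial.C d

/-- The numerator `e - a y` of the first coordinate of the parametrization. -/
def paramNumer (a e : ℝ) : Polynomial ℝ := Polynomial.C e - Polynomial.C a * Polynomial.X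

theorem eval_paramDenom (t : ℝ) : (paramDenom d).eval t = t ^ 2 - d := by
  simp [paramDenom]

theorem eval_paramNumer (t : ℝ) : (paramNumer a e).eval t = e - a * t := by
  simp [paramNumer]

theorem monic_paramDenom (d : ℝ) : (paramDenom d).Monic :=
  Polynomial.monic_X_pow_sub_C d two_ne_zero

theorem natDegree_paramDenom (d : ℝ) : (paramDenom d).natDegree = 2 :=
  Polynomial.natDegree_X_pow_sub_C

theorem natDegree_paramDenom_mul {q : Polynomial ℝ} (hq : q ≠ 0) :
    (paramDenom d * q).natDegree = 2 + q.natDegree := by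
  rw [(monic_paramDenom d).natDegree_mul' hq, natDegree_paramDenom]

theorem natDegree_paramNumer_le (a e : ℝ) : (paramNumer a e).natDegree ≤ 1 := by
  unfold paramNumer
  compute_degree

theorem natDegree_paramNumer_pow_mul_le (a d e : ℝ) (i j l : ℕ) :
    (paramNumer a e ^ i * Polynomial.X ^ j * paramDenom d ^ l).natDegree ≤ i + j + 2 * l := by
  have hi := Polynomial.natDegree_pow_le_of_le i (natDegree_paramNumer_le a e)
  have hl := Polynomial.natDegree_pow_le_of_le l (natDegree_paramDenom d).le
  convert Polynomial.natDegree_mul_le_of_le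
    (Polynomial.natDegree_mul_le_of_le hi (Polynomial.natDegree_X_pow_le j)) hl using 1
  ring

/-- The root `i√(-d)` of `y² - d`, at which the parametrization has a pole. -/
def pole (d : ℝ) : ℂ := ⟨0, √(-d)⟩

theorem pole_sq (hd : d < 0) : pole d ^ 2 = d := by
  have h := Real.mul_self_sqrt (neg_nonneg.2 hd.le)
  apply Complex.ext <;> simp [pole, pow_two, h]

theorem pole_im_ne_zero (hd : d < 0) : (pole d).im ≠ 0 :=
  (Real.sqrt_pos.2 (neg_pos.2 hd)).ne'

theorem exists_eq_add_mul_pole (hd : d < 0) (ζ : ℂ) : ∃ α β : ℝ, ζ = α + β * pole d := by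
  refine ⟨ζ.re, ζ.im / (pole d).im, ?_⟩
  have hre : (pole d).re = 0 := rfl
  apply Complex.ext <;> simp [hre, pole_im_ne_zero hd]

theorem aeval_pole_paramDenom (hd : d < 0) : Polynomial.aeval (pole d) (paramDenom d) = 0 := by
  simp [paramDenom, pole_sq hd]

theorem paramDenom_dvd (hd : d < 0) {p : Polynomial ℝ} (hp : Polynomial.aeval (pole d) p = 0) :
    paramDenom d ∣ p := by
  convert p.quadratic_dvd_of_aeval_eq_zero_im_ne_zero hp (pole_im_ne_zero hd) using 1
  have hnorm : ‖pole d‖ ^ 2 = -d := by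
    rw [Complex.sq_norm, Complex.normSq_apply]
    simp [pole, Real.mul_self_sqrt (neg_nonneg.2 hd.le)]
  have hre : (pole d).re = 0 := rfl
  simp [paramDenom, hnorm, hre, sub_eq_add_neg]

/-- The value of `e - a y` at the pole; it spans the values at the pole of the numerators of the
functions in `ℝ[C]_{≤ 1}`. -/
def poleValue (a d e : ℝ) : ℂ := Polynomial.aeval (pole d) (paramNumer a e)

theorem aeval_pole_paramNumer :
    Polynomial.aeval (pole d) (paramNumer a e) = poleValue a d e := rfl

theorem poleValue_ne_zero (hd : d < 0) (hP : Irreducible (P6 a d e)) : poleValue a d e ≠ 0 := by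
  intro h
  have hre : (pole d).re = 0 := rfl
  have ha : a = 0 := by
    simpa [poleValue, paramNumer, pole_im_ne_zero hd] using congrArg Complex.im h
  have he : e = 0 := by simpa [poleValue, paramNumer, hre] using congrArg Complex.re h
  have hfac : P6 a d e = X 0 * (X 1 ^ 2 - C d) := by
    simp only [P6, ha, he, C_0]
    ring
  rcases hP.isUnit_or_isUnit hfac with hu | hu
  · simpa using hu.map (eval (0 : Fin 2 → ℝ))
  · simpa [pole_sq hd] using hu.map (MvPolynomial.aeval (R := ℝ) fun _ : Fin 2 => pole d)

end Parametrization

section IsNumerator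

variable {m n : ℕ} {f g : CoordRing (curve6 a d e)} {p q : Polynomial ℝ}

/-- `f (y² - d)ᵐ` is the polynomial `q(y)` as a function on the curve: along the parametrization
`f` is the fraction `q / (y² - d)ᵐ`. -/
def IsNumerator (m : ℕ) (f : CoordRing (curve6 a d e)) (q : Polynomial ℝ) : Prop :=
  ∀ v (hv : v ∈ curve6 a d e), evalAt v hv f * (v 1 ^ 2 - d) ^ m = q.eval (v 1)

theorem IsNumerator.add (hf : IsNumerator m f p) (hg : IsNumerator m g q) :
    IsNumerator m (f + g) (p + q) := fun v hv => by
  rw [map_add, add_mul, hf v hv, hg v hv, Polynomial.eval_add]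

theorem IsNumerator.smul (c : ℝ) (hf : IsNumerator m f p) :
    IsNumerator m (c • f) (c • p) := fun v hv => by
  rw [map_smul, smul_mul_assoc, hf v hv, Polynomial.eval_smul]

theorem IsNumerator.zero : IsNumerator m (0 : CoordRing (curve6 a d e)) 0 := fun v hv => by
  simp

theorem IsNumerator.mul (hf : IsNumerator m f p) (hg : IsNumerator n g q) :
    IsNumerator (m + n) (f * g) (p * q) := fun v hv => by
  rw [map_mul, Polynomial.eval_mul, ← hf v hv, ← hg v hv]
  ring

theorem IsNumerator.mul_self (hf : IsNumerator m f p) : IsNumerator (2 * m) (f * f) (p * p) :=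
  two_mul m ▸ hf.mul hf

theorem IsNumerator.paramDenom_mul (hf : IsNumerator m f p) :
    IsNumerator (m + 1) f (paramDenom d * p) := fun v hv => by
  rw [Polynomial.eval_mul, ← hf v hv, eval_paramDenom]
  ring

theorem IsNumerator.eq (hd : d < 0) (hf : IsNumerator m f p) (hg : IsNumerator m g p) : f = g :=
  eq_of_evalAt_eq fun v hv => mul_right_cancel₀ (pow_ne_zero m (sq_sub_pos hd (v 1)).ne')
    ((hf v hv).trans (hg v hv).symm)

theorem IsNumerator.unique (hd : d < 0) (hf : IsNumerator m f p) (hg : IsNumerator m f q) :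
    p = q :=
  Polynomial.funext fun t => (hf (param a d e t) (param_mem_curve6 hd t)).symm.trans
    (hg (param a d e t) (param_mem_curve6 hd t))

theorem isNumerator_mon {i : ℕ} (hi : i ≤ m) (j : ℕ) :
    IsNumerator m (mon (curve6 a d e) i j)
      (paramNumer a e ^ i * Polynomial.X ^ j * paramDenom d ^ (m - i)) := fun v hv => by
  obtain ⟨l, rfl⟩ := Nat.exists_eq_add_of_le hi
  simp only [Polynomial.eval_mul, Polynomial.eval_pow, Polynomial.eval_X, eval_paramNumer,
    eval_paramDenom, Nat.add_sub_cancel_left, evalAt_mon, ← mem_curve6_iff.1 hv, mul_pow, pow_add]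
  ring

theorem isNumerator_mon_self (m j : ℕ) :
    IsNumerator m (mon (curve6 a d e) m j) (paramNumer a e ^ m * Polynomial.X ^ j) := by
  simpa using isNumerator_mon (le_refl m) j

theorem exists_isNumerator_succ (hd : d < 0) {S : Submodule ℝ (CoordRing (curve6 a d e))}
    (hS : ∀ s : Polynomial ℝ, s.natDegree ≤ n → ∃ f ∈ S, IsNumerator m f s)
    (hf : IsNumerator (m + 1) f p) (hp : p.natDegree ≤ n + 2) (hq : q.natDegree ≤ n + 2)
    (hpq : Polynomial.aeval (pole d) p = Polynomial.aeval (pole d) q) :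
    ∃ g ∈ S, IsNumerator (m + 1) (f + g) q := by
  obtain ⟨s, hs⟩ := paramDenom_dvd hd (p := q - p) (by rw [map_sub, hpq, sub_self])
  have hsdeg : s.natDegree ≤ n := by
    obtain rfl | hs0 := eq_or_ne s 0
    · simp
    have hdeg := Polynomial.natDegree_sub_le_of_le hq hp
    rw [hs, natDegree_paramDenom_mul hs0] at hdeg
    omega
  obtain ⟨g, hg, hgs⟩ := hS s hsdeg
  have hfg := hf.add hgs.paramDenom_mul
  rw [← hs, add_sub_cancel] at hfg
  exact ⟨g, hg, hfg⟩

end IsNumerator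

section NumeratorSpace

/-- The functions on the curve that are of the form `q / (y² - d)ᵐ` with `q` of degree at most `n`
and value in `ℝ ω` at the pole. -/
def numeratorSpace (a d e : ℝ) (m n : ℕ) (ω : ℂ) : Submodule ℝ (CoordRing (curve6 a d e)) where
  carrier := {f | ∃ q : Polynomial ℝ, q.natDegree ≤ n ∧
    Polynomial.aeval (pole d) q ∈ (ℝ ∙ ω) ∧ IsNumerator m f q}
  zero_mem' := ⟨0, by simp, by simp, IsNumerator.zero⟩
  add_mem' := by
    rintro f g ⟨p, hp, hpω, hf⟩ ⟨q, hq, hqω, hg⟩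
    exact ⟨p + q, Polynomial.natDegree_add_le_of_degree_le hp hq,
      map_add (Polynomial.aeval (pole d)) p q ▸ add_mem hpω hqω, hf.add hg⟩
  smul_mem' := by
    rintro c f ⟨p, hp, hpω, hf⟩
    exact ⟨c • p, (Polynomial.natDegree_smul_le c p).trans hp,
      map_smul (Polynomial.aeval (pole d)) c p ▸ Submodule.smul_mem _ c hpω, hf.smul c⟩

theorem mon_mem_numeratorSpace (hd : d < 0) {i j m n : ℕ} {ω : ℂ} (hi : i ≤ m)
    (hn : i + j + 2 * (m - i) ≤ n) (hω : i = m → ω = poleValue a d e ^ m * pole d ^ j) :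
    mon (curve6 a d e) i j ∈ numeratorSpace a d e m n ω := by
  refine ⟨_, (natDegree_paramNumer_pow_mul_le a d e i j (m - i)).trans hn, ?_,
    isNumerator_mon hi j⟩
  simp only [map_mul, map_pow, Polynomial.aeval_X, aeval_pole_paramDenom hd, aeval_pole_paramNumer]
  obtain rfl | hlt := hi.eq_or_lt
  · simp [hω rfl, Submodule.mem_span_singleton_self]
  · simp [(Nat.sub_pos_of_lt hlt).ne']

theorem coordLE_le_numeratorSpace (hd : d < 0) (m : ℕ) :
    CoordLE (curve6 a d e) m ≤ numeratorSpace a d e m (3 * m) (poleValue a d e ^ m) := by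
  rw [CoordLE, PolyLE, restrictTotalDegree, restrictSupport_eq_span, Submodule.map_span,
    Submodule.span_le]
  rintro _ ⟨_, ⟨s, hs, rfl⟩, rfl⟩
  have hle : s 0 + s 1 ≤ m := by
    simpa [Finsupp.sum_fintype] using hs
  have hmon : (monomial s 1 : MvPolynomial (Fin 2) ℝ) = X 0 ^ s 0 * X 1 ^ s 1 := by
    rw [monomial_eq, C_1, one_mul, Finsupp.prod_fintype _ _ (by simp), Fin.prod_univ_two]
  change restr (curve6 a d e) (monomial s 1) ∈ _
  rw [hmon]
  exact mon_mem_numeratorSpace hd (by omega) (by omega) fun h => by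
    rw [show s 1 = 0 by omega, pow_zero, mul_one]

/-- The numerator over `(y² - d)ᵐ` of a function in `ℝ[C]_{≤ m}`. -/
def numerator (hd : d < 0) (m : ℕ) : CoordLE (curve6 a d e) m →ₗ[ℝ] Polynomial ℝ :=
  have h (f : CoordLE (curve6 a d e) m) := (coordLE_le_numeratorSpace hd m f.2).choose_spec.2.2
  { toFun := fun f => (coordLE_le_numeratorSpace hd m f.2).choose
    map_add' := fun f g => (h (f + g)).unique hd ((h f).add (h g))
    map_smul' := fun c f => (h (c • f)).unique hd ((h f).smul c) }

variable {m : ℕ}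

theorem isNumerator_numerator (hd : d < 0) (f : CoordLE (curve6 a d e) m) :
    IsNumerator m (f : CoordRing (curve6 a d e)) (numerator hd m f) :=
  (coordLE_le_numeratorSpace hd m f.2).choose_spec.2.2

theorem natDegree_numerator_le (hd : d < 0) (f : CoordLE (curve6 a d e) m) :
    (numerator hd m f).natDegree ≤ 3 * m :=
  (coordLE_le_numeratorSpace hd m f.2).choose_spec.1

theorem aeval_pole_numerator_mem (hd : d < 0) (f : CoordLE (curve6 a d e) m) :
    Polynomial.aeval (pole d) (numerator hd m f) ∈ (ℝ ∙ poleValue a d e ^ m) :=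
  (coordLE_le_numeratorSpace hd m f.2).choose_spec.2.1

end NumeratorSpace

section TwistedSpan

/-- `{xⁿ, xⁿy, …, x, xy, 1, y, …, y^K}`; it spans the functions with numerator over `(y² - d)ⁿ` of
degree at most `2n + K`. -/
def coreSet (C : Set (Fin 2 → ℝ)) (n K : ℕ) : Set (CoordRing C) :=
  {b | ∃ i, 1 ≤ i ∧ i ≤ n ∧ (b = mon C i 0 ∨ b = mon C i 1)} ∪ {b | ∃ j ≤ K, b = mon C 0 j}

theorem coreSet_subset_succ (C : Set (Fin 2 → ℝ)) (n K : ℕ) :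
    coreSet C n K ⊆ coreSet C (n + 1) K :=
  Set.union_subset_union_left _ fun _ ⟨i, hi, hin, h⟩ => ⟨i, hi, hin.trans n.le_succ, h⟩

theorem exists_isNumerator_zero (K : ℕ) (q : Polynomial ℝ) (hq : q.natDegree ≤ K) :
    ∃ f ∈ Submodule.span ℝ (coreSet (curve6 a d e) 0 K), IsNumerator 0 f q := by
  refine ⟨∑ j ∈ Finset.range (K + 1), q.coeff j • mon (curve6 a d e) 0 j, ?_, fun v hv => ?_⟩
  · refine Submodule.sum_mem _ fun j hj => Submodule.smul_mem _ _ (Submodule.subset_span ?_)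
    exact Or.inr ⟨j, Nat.lt_succ_iff.1 (Finset.mem_range.1 hj), rfl⟩
  · rw [Polynomial.eval_eq_sum_range' (Nat.lt_succ_of_le hq), map_sum]
    simp [evalAt_mon]

theorem exists_isNumerator_coreSet (hd : d < 0) (hω : poleValue a d e ≠ 0) (n K : ℕ)
    (q : Polynomial ℝ) (hq : q.natDegree ≤ 2 * n + K) :
    ∃ f ∈ Submodule.span ℝ (coreSet (curve6 a d e) n K), IsNumerator n f q := by
  induction n generalizing q with
  | zero => exact exists_isNumerator_zero K q (by omega)
  | succ n ih =>
    obtain ⟨α, β, hαβ⟩ := exists_eq_add_mul_pole hd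
      (Polynomial.aeval (pole d) q / poleValue a d e ^ (n + 1))
    rw [div_eq_iff (pow_ne_zero _ hω)] at hαβ
    have hnum := ((isNumerator_mon_self (d := d) (n + 1) 0).smul α).add
      ((isNumerator_mon_self (a := a) (e := e) (n + 1) 1).smul β)
    have hlead (j : ℕ) : (paramNumer a e ^ (n + 1) * Polynomial.X ^ j).natDegree ≤ n + 1 + j := by
      simpa using natDegree_paramNumer_pow_mul_le a d e (n + 1) j 0
    have hdeg : (α • (paramNumer a e ^ (n + 1) * Polynomial.X ^ 0) +
        β • (paramNumer a e ^ (n + 1) * Polynomial.X ^ 1)).natDegree ≤ 2 * n + K + 2 :=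
      Polynomial.natDegree_add_le_of_degree_le
        ((Polynomial.natDegree_smul_le _ _).trans ((hlead 0).trans (by omega)))
        ((Polynomial.natDegree_smul_le _ _).trans ((hlead 1).trans (by omega)))
    have hval : Polynomial.aeval (pole d) (α • (paramNumer a e ^ (n + 1) * Polynomial.X ^ 0) +
        β • (paramNumer a e ^ (n + 1) * Polynomial.X ^ 1)) = Polynomial.aeval (pole d) q := by
      simp only [hαβ, map_add, map_smul, map_mul, map_pow, Polynomial.aeval_X,
        aeval_pole_paramNumer, Complex.real_smul]
      ring
    obtain ⟨f, hf, hfq⟩ := exists_isNumerator_succ hd ih hnum hdeg (by omega) hval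
    refine ⟨_, add_mem (add_mem ?_ ?_) (Submodule.span_mono (coreSet_subset_succ _ n K) hf), hfq⟩
    · exact Submodule.smul_mem _ _ <| Submodule.subset_span <|
        Or.inl ⟨n + 1, by omega, le_rfl, Or.inl rfl⟩
    · exact Submodule.smul_mem _ _ <| Submodule.subset_span <|
        Or.inl ⟨n + 1, by omega, le_rfl, Or.inr rfl⟩

/-- `ℬ_k` for `ε = 0` and `ℬ̃_k` for `ε = 1`. -/
def twistedBasis (C : Set (Fin 2 → ℝ)) (k : ℕ) (ε : Fin 2) : Set (CoordRing C) :=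
  {mon C k ε} ∪ basisCore C k

/-- `Lin ℬ_k` for `ε = 0` and `Lin ℬ̃_k` for `ε = 1`. -/
def twistedSpan (a d e : ℝ) (k : ℕ) (ε : Fin 2) : Submodule ℝ (CoordRing (curve6 a d e)) :=
  Submodule.span ℝ (twistedBasis (curve6 a d e) k ε)

/-- `U` for `ε = 0` and, inside `ℝ[C]`, `W` for `ε = 1`. -/
def twistedHyperplane (a d e : ℝ) (k : ℕ) (ε : Fin 2) : Submodule ℝ (CoordRing (curve6 a d e)) :=
  Submodule.span ℝ (twistedBasis (curve6 a d e) k ε \ {mon (curve6 a d e) 0 k})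

theorem mon_zero_mem_twistedBasis (C : Set (Fin 2 → ℝ)) (k : ℕ) (ε : Fin 2) :
    mon C 0 k ∈ twistedBasis C k ε :=
  Or.inr (Or.inr ⟨k, le_rfl, rfl⟩)

theorem twistedSpan_le_numeratorSpace (hd : d < 0) (hk : 1 ≤ k) :
    twistedSpan a d e k ε ≤ numeratorSpace a d e k (3 * k)
      (poleValue a d e ^ k * pole d ^ (ε : ℕ)) := by
  refine Submodule.span_le.2 ?_
  rintro _ (rfl | ⟨i, _, hik, rfl | rfl⟩ | ⟨j, hj, rfl⟩)
  · exact mon_mem_numeratorSpace hd le_rfl (by omega) fun _ => rfl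
  all_goals exact mon_mem_numeratorSpace hd (by omega) (by omega) (by omega)

theorem twistedHyperplane_le_numeratorSpace (hd : d < 0) (hk : 1 ≤ k) :
    twistedHyperplane a d e k ε ≤
      numeratorSpace a d e k (3 * k - 1) (poleValue a d e ^ k * pole d ^ (ε : ℕ)) := by
  refine Submodule.span_le.2 ?_
  rintro _ ⟨rfl | ⟨i, hi, hik, rfl | rfl⟩ | ⟨j, hj, rfl⟩, hne⟩
  · exact mon_mem_numeratorSpace hd le_rfl (by omega) fun _ => rfl
  · exact mon_mem_numeratorSpace hd (by omega) (by omega) (by omega)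
  · exact mon_mem_numeratorSpace hd (by omega) (by omega) (by omega)
  · have hjk : j ≠ k := fun h => hne (h ▸ rfl)
    exact mon_mem_numeratorSpace hd (by omega) (by omega) (by omega)

theorem exists_isNumerator_twistedSpan (hd : d < 0) (hω : poleValue a d e ≠ 0) (hk : 1 ≤ k)
    {q : Polynomial ℝ} (hq : q.natDegree ≤ 3 * k)
    (hqω : Polynomial.aeval (pole d) q ∈ (ℝ ∙ poleValue a d e ^ k * pole d ^ (ε : ℕ))) :
    ∃ f ∈ twistedSpan a d e k ε, IsNumerator k f q := by
  obtain ⟨r, hr⟩ := Submodule.mem_span_singleton.1 hqω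
  obtain ⟨n, rfl⟩ := Nat.exists_eq_add_of_le' hk
  have hlead : (paramNumer a e ^ (n + 1) * Polynomial.X ^ (ε : ℕ)).natDegree ≤ n + 1 + ε := by
    simpa using natDegree_paramNumer_pow_mul_le a d e (n + 1) ε 0
  obtain ⟨g, hg, hgq⟩ := exists_isNumerator_succ (q := q) hd
    (exists_isNumerator_coreSet hd hω n (n + 1)) ((isNumerator_mon_self (n + 1) ε).smul r)
    ((Polynomial.natDegree_smul_le _ _).trans (hlead.trans (by omega))) (by omega)
    (by simp only [← hr, map_smul, map_mul, map_pow, Polynomial.aeval_X, aeval_pole_paramNumer])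
  exact ⟨_, add_mem (Submodule.smul_mem _ _ (Submodule.subset_span (Or.inl rfl)))
    (Submodule.span_mono Set.subset_union_right hg), hgq⟩

theorem coordLE_eq_twistedSpan (hd : d < 0) (hω : poleValue a d e ≠ 0) (hk : 1 ≤ k) :
    CoordLE (curve6 a d e) k = twistedSpan a d e k 0 := by
  apply le_antisymm
  · intro f hf
    obtain ⟨q, hq, hqω, hfq⟩ := coordLE_le_numeratorSpace hd k hf
    obtain ⟨g, hg, hgq⟩ := exists_isNumerator_twistedSpan (ε := 0) hd hω hk hq (by simpa using hqω)
    rwa [hfq.eq hd hgq]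
  · refine Submodule.span_le.2 ?_
    rintro _ (rfl | ⟨i, _, hik, rfl | rfl⟩ | ⟨j, hj, rfl⟩) <;> exact mon_mem _ (by simp <;> omega)

theorem Vk_eq_map (a d e : ℝ) (k : ℕ) :
    Vk (curve6 a d e) k = (twistedSpan a d e k 1).map (toFrac _) :=
  (Submodule.map_span _ _).symm

theorem mul_mem_coordLE (hk : 1 ≤ k) {g h : CoordRing (curve6 a d e)}
    (hg : g ∈ twistedSpan a d e k 1) (hh : h ∈ twistedSpan a d e k 1) :
    g * h ∈ CoordLE (curve6 a d e) (2 * k) := by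
  have hgV := Vk_eq_map a d e k ▸ Submodule.mem_map_of_mem hg
  have hhV := Vk_eq_map a d e k ▸ Submodule.mem_map_of_mem hh
  obtain ⟨f, hf, hfgh⟩ := admissible_Vk a d e hk _ hgV _ hhV
  have hfeq : f = g * h := toFrac_injective _ (hfgh.trans (by simp))
  exact hfeq ▸ hf

theorem mul_self_mem_coordLE (hd : d < 0) (hω : poleValue a d e ≠ 0) (hk : 1 ≤ k)
    {g : CoordRing (curve6 a d e)} (hg : g ∈ twistedSpan a d e k ε) :
    g * g ∈ CoordLE (curve6 a d e) (2 * k) := by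
  obtain rfl | rfl : ε = 0 ∨ ε = 1 := by omega
  · rw [← coordLE_eq_twistedSpan hd hω hk] at hg
    exact coordLE_mul_mem hg hg
  · exact mul_mem_coordLE hk hg hg

theorem coeff_eq_zero_of_mem_twistedHyperplane (hd : d < 0) (hk : 1 ≤ k)
    {g : CoordRing (curve6 a d e)} (hg : g ∈ twistedHyperplane a d e k ε) {q : Polynomial ℝ}
    (hq : IsNumerator k g q) : q.coeff (3 * k) = 0 := by
  obtain ⟨p, hp, -, hgp⟩ := twistedHyperplane_le_numeratorSpace hd hk hg
  rw [hq.unique hd hgp]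
  exact Polynomial.coeff_eq_zero_of_natDegree_lt (by omega)

theorem isNumerator_mon_zero (k : ℕ) :
    IsNumerator k (mon (curve6 a d e) 0 k) (Polynomial.X ^ k * paramDenom d ^ k) := by
  simpa using isNumerator_mon k.zero_le k

theorem coeff_X_pow_mul_paramDenom_pow (d : ℝ) (k : ℕ) :
    (Polynomial.X ^ k * paramDenom d ^ k).coeff (3 * k) = 1 := by
  have hpow := (monic_paramDenom d).pow k
  have hdeg : (Polynomial.X ^ k * paramDenom d ^ k).natDegree = 3 * k := by
    rw [(Polynomial.monic_X_pow k).natDegree_mul hpow, Polynomial.natDegree_X_pow,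
      (monic_paramDenom d).natDegree_pow, natDegree_paramDenom]
    ring
  rw [← hdeg]
  exact ((Polynomial.monic_X_pow k).mul hpow).coeff_natDegree

theorem mon_zero_notMem_twistedHyperplane (hd : d < 0) (hk : 1 ≤ k) :
    mon (curve6 a d e) 0 k ∉ twistedHyperplane a d e k ε := fun hmem => by
  have hcoeff := coeff_eq_zero_of_mem_twistedHyperplane hd hk hmem (isNumerator_mon_zero k)
  exact one_ne_zero ((coeff_X_pow_mul_paramDenom_pow d k).symm.trans hcoeff)

theorem twistedHyperplane_covBy_twistedSpan (hd : d < 0) (hk : 1 ≤ k) :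
    twistedHyperplane a d e k ε ⋖ twistedSpan a d e k ε :=
  span_sdiff_covBy_span (mon_zero_mem_twistedBasis _ k ε) (mon_zero_notMem_twistedHyperplane hd hk)

theorem mem_twistedHyperplane_iff (hd : d < 0) (hk : 1 ≤ k)
    {g : CoordRing (curve6 a d e)} (hg : g ∈ twistedSpan a d e k ε) {q : Polynomial ℝ}
    (hq : IsNumerator k g q) : g ∈ twistedHyperplane a d e k ε ↔ q.coeff (3 * k) = 0 := by
  refine ⟨fun h => coeff_eq_zero_of_mem_twistedHyperplane hd hk h hq, fun hcoeff => ?_⟩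
  rw [twistedSpan, ← Set.insert_sdiff_self_of_mem (mon_zero_mem_twistedBasis _ k ε),
    Submodule.mem_span_insert] at hg
  obtain ⟨r, u, hu, rfl⟩ := hg
  obtain ⟨p, hp, -, hup⟩ := twistedHyperplane_le_numeratorSpace hd hk hu
  have hr : r = 0 := by
    rwa [hq.unique hd (((isNumerator_mon_zero k).smul r).add hup), Polynomial.coeff_add,
      Polynomial.coeff_smul, coeff_X_pow_mul_paramDenom_pow, smul_eq_mul, mul_one,
      Polynomial.coeff_eq_zero_of_natDegree_lt (by omega), add_zero] at hcoeff
  rwa [hr, zero_smul, zero_add]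

end TwistedSpan

section HomogEval

/-- The homogenization of a polynomial in degree `n`, as a function of the point `s + ir` of the
unit circle. The point `s + ir` corresponds to `t = s / r`, and `± 1` to `t = ∞`. -/
def homogEval (n : ℕ) : Polynomial ℝ →ₗ[ℝ] C(Metric.sphere (0 : ℂ) 1, ℝ) where
  toFun q := ⟨fun x => eval ![(x : ℂ).re, (x : ℂ).im] (q.homogenize n),
    (MvPolynomial.continuous_eval _).comp (continuous_pi fun i => by fin_cases i <;> fun_prop)⟩
  map_add' p q := by ext x; simp
  map_smul' c q := by ext x; simp

variable {m n : ℕ} {p q : Polynomial ℝ} {x : Metric.sphere (0 : ℂ) 1}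

theorem homogEval_apply (n : ℕ) (q : Polynomial ℝ) (x : Metric.sphere (0 : ℂ) 1) :
    homogEval n q x = eval ![(x : ℂ).re, (x : ℂ).im] (q.homogenize n) := rfl

theorem homogEval_of_im_ne_zero (hq : q.natDegree ≤ n) (hx : (x : ℂ).im ≠ 0) :
    homogEval n q x = q.eval ((x : ℂ).re / (x : ℂ).im) * (x : ℂ).im ^ n :=
  Polynomial.eval_homogenize hq _ hx

theorem homogEval_of_im_eq_zero (n : ℕ) (q : Polynomial ℝ) (hx : (x : ℂ).im = 0) :
    homogEval n q x = q.coeff n * (x : ℂ).re ^ n := by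
  rw [homogEval_apply, Polynomial.homogenize, map_sum,
    Finset.Nat.sum_antidiagonal_eq_sum_range_succ_mk, Finset.sum_range_succ, Finset.sum_eq_zero,
    zero_add]
  · simp [MvPolynomial.eval_monomial, Finsupp.prod_fintype]
  · intro j hj
    have hne : n - j ≠ 0 := by have := Finset.mem_range.1 hj; omega
    simp [MvPolynomial.eval_monomial, Finsupp.prod_fintype, hx, hne]

theorem homogEval_mul_self (hq : q.natDegree ≤ n) (x : Metric.sphere (0 : ℂ) 1) :
    homogEval (2 * n) (q * q) x = homogEval n q x ^ 2 := by
  rw [homogEval_apply, two_mul, Polynomial.homogenize_mul q q hq hq, map_mul, ← pow_two,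
    homogEval_apply]

theorem re_ne_zero_of_im_eq_zero (hx : (x : ℂ).im = 0) : (x : ℂ).re ≠ 0 := fun hre => by
  have hx0 : (x : ℂ) = 0 := Complex.ext hre hx
  exact ne_of_mem_of_not_mem x.2 (by simp) hx0

theorem exists_re_div_im_eq (t : ℝ) :
    ∃ x : Metric.sphere (0 : ℂ) 1, (x : ℂ).im ≠ 0 ∧ (x : ℂ).re / (x : ℂ).im = t := by
  have hz : (⟨t, 1⟩ : ℂ) ≠ 0 := fun h => one_ne_zero (congrArg Complex.im h)
  have hnorm := norm_ne_zero_iff.2 hz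
  refine ⟨⟨(‖(⟨t, 1⟩ : ℂ)‖⁻¹ : ℝ) * ⟨t, 1⟩, by simp [hnorm]⟩, by simp [hz], ?_⟩
  simp only [Complex.re_ofReal_mul, Complex.im_ofReal_mul]
  field_simp

theorem nonneg_of_homogEval_nonneg (hq : q.natDegree ≤ 2 * n)
    (h : ∀ x, 0 ≤ homogEval (2 * n) q x) (t : ℝ) : 0 ≤ q.eval t := by
  obtain ⟨x, hx, rfl⟩ := exists_re_div_im_eq t
  have hpos : 0 < (x : ℂ).im ^ (2 * n) := by rw [pow_mul]; positivity
  exact nonneg_of_mul_nonneg_left (homogEval_of_im_ne_zero hq hx ▸ h x) hpos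

theorem homogEval_paramDenom_pow_pos (hd : d < 0) (n : ℕ)
    (x : Metric.sphere (0 : ℂ) 1) : 0 < homogEval (2 * n) (paramDenom d ^ n) x := by
  have hmonic := (monic_paramDenom d).pow n
  have hdeg : (paramDenom d ^ n).natDegree = 2 * n := by
    rw [(monic_paramDenom d).natDegree_pow, natDegree_paramDenom, mul_comm]
  by_cases hx : (x : ℂ).im = 0
  · have hre := re_ne_zero_of_im_eq_zero hx
    rw [homogEval_of_im_eq_zero _ _ hx, ← hdeg, hmonic.coeff_natDegree, hdeg, one_mul, pow_mul]
    positivity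
  · have ht := sq_sub_pos hd ((x : ℂ).re / (x : ℂ).im)
    rw [homogEval_of_im_ne_zero hdeg.le hx, Polynomial.eval_pow, eval_paramDenom, pow_mul]
    positivity

theorem integrable_continuousMap {X : Type*} [TopologicalSpace X] [CompactSpace X]
    [MeasurableSpace X] [OpensMeasurableSpace X] (ν : Measure X) [IsFiniteMeasure ν] (φ : C(X, ℝ)) :
    Integrable (fun x => φ x) ν :=
  φ.continuous.integrable_of_hasCompactSupport (HasCompactSupport.of_compactSpace _)

theorem ae_im_ne_zero_of_integral_eq_zero {ν : Measure (Metric.sphere (0 : ℂ) 1)}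
    [IsFiniteMeasure ν] (hq : q.natDegree ≤ n) (hlead : q.coeff n ≠ 0)
    (h : ∫ x, homogEval (2 * n) (q * q) x ∂ν = 0) :
    ∀ᵐ x : Metric.sphere (0 : ℂ) 1 ∂ν, (x : ℂ).im ≠ 0 := by
  have hnonneg (x) : 0 ≤ homogEval (2 * n) (q * q) x := homogEval_mul_self hq x ▸ sq_nonneg _
  filter_upwards [(integral_eq_zero_iff_of_nonneg hnonneg (integrable_continuousMap ν _)).1 h]
    with x hx him
  rw [Pi.zero_apply, homogEval_mul_self hq, homogEval_of_im_eq_zero _ _ him] at hx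
  exact pow_ne_zero 2 (mul_ne_zero hlead (pow_ne_zero _ (re_ne_zero_of_im_eq_zero him))) hx

end HomogEval

section CircleMeasure

theorem exists_eq_mul_self_add_mul_self (hd : d < 0) (hω : poleValue a d e ≠ 0) (hk : 1 ≤ k)
    (f : CoordLE (curve6 a d e) (2 * k)) (hf : ∀ t, 0 ≤ (numerator hd (2 * k) f).eval t) :
    ∃ g ∈ twistedSpan a d e k 0, ∃ h ∈ twistedSpan a d e k 1,
      (f : CoordRing (curve6 a d e)) = g * g + h * h := by
  have hval : Polynomial.aeval (pole d) (numerator hd (2 * k) f) ∈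
      (ℝ ∙ (poleValue a d e ^ k) ^ 2) := by
    rw [← pow_mul, mul_comm k]
    exact aeval_pole_numerator_mem hd f
  obtain ⟨p, q, hpq, hp, hq⟩ := exists_eq_sq_add_sq_aeval_mem_span hf (pow_ne_zero k hω) hval
  have hpdeg : p.natDegree ≤ 3 * k := by
    have := hpq ▸ natDegree_numerator_le hd f
    have := natDegree_le_natDegree_sq_add_sq p q
    omega
  have hqdeg : q.natDegree ≤ 3 * k := by
    have := hpq ▸ natDegree_numerator_le hd f
    have := add_comm (q ^ 2) (p ^ 2) ▸ natDegree_le_natDegree_sq_add_sq q p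
    omega
  have hI : poleValue a d e ^ k * Complex.I ∈ (ℝ ∙ poleValue a d e ^ k * pole d ^ 1) := by
    refine Submodule.mem_span_singleton.2 ⟨(pole d).im⁻¹, ?_⟩
    have hpole : ((pole d).im : ℂ) * Complex.I = pole d := Complex.ext (by simp [pole]) (by simp)
    have him : ((pole d).im : ℂ) ≠ 0 := Complex.ofReal_ne_zero.2 (pole_im_ne_zero hd)
    rw [pow_one, ← hpole, Complex.real_smul, Complex.ofReal_inv]
    simp only [Complex.im_ofReal_mul, Complex.I_im, mul_one]
    field_simp
  obtain ⟨g, hg, hgp⟩ := exists_isNumerator_twistedSpan (ε := 0) hd hω hk hpdeg (by simpa using hp)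
  obtain ⟨h, hh, hhq⟩ := exists_isNumerator_twistedSpan (ε := 1) hd hω hk hqdeg
    ((Submodule.span_singleton_le_iff_mem _ _).2 hI hq)
  refine ⟨g, hg, h, hh, (isNumerator_numerator hd f).eq hd ?_⟩
  rw [hpq, pow_two, pow_two]
  exact hgp.mul_self.add hhq.mul_self

theorem exists_isNumerator_paramDenom_pow (hd : d < 0) (hω : poleValue a d e ≠ 0) (hk : 1 ≤ k) :
    ∃ f : CoordLE (curve6 a d e) (2 * k), numerator hd (2 * k) f = paramDenom d ^ (3 * k) := by
  have hdeg : (paramDenom d ^ (3 * k)).natDegree ≤ 3 * (2 * k) := by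
    rw [(monic_paramDenom d).natDegree_pow, natDegree_paramDenom]
    omega
  obtain ⟨f, hf, hfq⟩ := exists_isNumerator_twistedSpan (ε := 0) hd hω (by omega : 1 ≤ 2 * k) hdeg
    (by
      rw [map_pow, aeval_pole_paramDenom hd, zero_pow (by omega)]
      exact Submodule.zero_mem _)
  rw [← coordLE_eq_twistedSpan hd hω (by omega)] at hf
  exact ⟨⟨f, hf⟩, (isNumerator_numerator hd ⟨f, hf⟩).unique hd hfq⟩

theorem exists_measure_circle (hd : d < 0) (hω : poleValue a d e ≠ 0) (hk : 1 ≤ k)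
    (Λ : CoordRing (curve6 a d e) →ₗ[ℝ] ℝ)
    (hΛ : ∀ ε, ∀ g ∈ twistedSpan a d e k ε, 0 ≤ Λ (g * g)) :
    ∃ ν : Measure (Metric.sphere (0 : ℂ) 1), IsFiniteMeasure ν ∧
      ∀ f : CoordLE (curve6 a d e) (2 * k),
        Λ f = ∫ x, homogEval (2 * (3 * k)) (numerator hd (2 * k) f) x ∂ν := by
  obtain ⟨u, hu⟩ := exists_isNumerator_paramDenom_pow hd hω hk
  refine exists_measure_of_nonneg_on_nonneg
    (homogEval (2 * (3 * k)) ∘ₗ numerator (a := a) (e := e) hd (2 * k))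
    (Λ ∘ₗ (CoordLE _ _).subtype) (fun f hf => ?_) (u := u) fun x => ?_
  · have hdeg : (numerator hd (2 * k) f).natDegree ≤ 2 * (3 * k) :=
      (natDegree_numerator_le hd f).trans (by omega)
    obtain ⟨g, hg, h, hh, hfgh⟩ := exists_eq_mul_self_add_mul_self hd hω hk f
      (nonneg_of_homogEval_nonneg hdeg hf)
    change 0 ≤ Λ f
    rw [hfgh, map_add]
    exact add_nonneg (hΛ 0 g hg) (hΛ 1 h hh)
  · simpa only [LinearMap.comp_apply, hu] using homogEval_paramDenom_pow_pos hd (3 * k) x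

end CircleMeasure

section MomentFunctional

theorem isMomentFunctional_of_parametrization {X : Type*} [MeasurableSpace X] {ν : Measure X}
    {K : Set (Fin 2 → ℝ)} (hK : MeasurableSet K) {m : ℕ} {L : PolyLE m →ₗ[ℝ] ℝ}
    {Φ : X → Fin 2 → ℝ} (hΦ : Measurable Φ) (hΦK : ∀ x, Φ x ∈ K) {w : X → NNReal}
    (hw : Measurable w)
    (hL : ∀ p : PolyLE m, Integrable (fun x => w x • eval (Φ x) (p : MvPolynomial (Fin 2) ℝ)) ν ∧
      L p = ∫ x, w x • eval (Φ x) (p : MvPolynomial (Fin 2) ℝ) ∂ν) :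
    IsMomentFunctional K L := by
  have hsupp : ∀ᵐ v ∂(ν.withDensity fun x => w x).map Φ, v ∈ K :=
    (ae_map_iff hΦ.aemeasurable hK).2 (ae_of_all _ hΦK)
  refine ⟨(ν.withDensity fun x => w x).map Φ, hsupp, fun p => ?_⟩
  have hp := (MvPolynomial.continuous_eval (p : MvPolynomial (Fin 2) ℝ)).aestronglyMeasurable
    (μ := (ν.withDensity fun x => w x).map Φ)
  rw [Measure.restrict_eq_self_of_ae_mem hsupp, integral_map hΦ.aemeasurable hp,
    integral_withDensity_eq_integral_smul hw, integrable_map_measure hp hΦ.aemeasurable,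
    integrable_withDensity_iff_integrable_smul hw]
  exact hL p

theorem measurableSet_curve6 (a d e : ℝ) : MeasurableSet (curve6 a d e) :=
  (isClosed_eq (MvPolynomial.continuous_eval (P6 a d e)) continuous_const).measurableSet

theorem measurable_param_comp {X : Type*} [MeasurableSpace X] {t : X → ℝ} (ht : Measurable t)
    (a d e : ℝ) : Measurable fun x => param a d e (t x) := by
  refine measurable_pi_iff.2 fun i => ?_
  fin_cases i
  · exact (measurable_const.sub (ht.const_mul a)).div ((ht.pow_const 2).sub_const d)
  · exact ht

theorem isMomentFunctional_of_measure_circle (hd : d < 0) {m n : ℕ} (hmn : 3 * m ≤ 2 * n)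
    {L : PolyLE m →ₗ[ℝ] ℝ} {ν : Measure (Metric.sphere (0 : ℂ) 1)} [IsFiniteMeasure ν]
    (hν : ∀ᵐ x : Metric.sphere (0 : ℂ) 1 ∂ν, (x : ℂ).im ≠ 0)
    (hL : ∀ p : PolyLE m, L p = ∫ x, homogEval (2 * n)
      (numerator hd m ⟨restr (curve6 a d e) p, restr_mem p.2⟩) x ∂ν) :
    IsMomentFunctional (curve6 a d e) L := by
  have hdeg : (paramDenom d ^ m).natDegree ≤ 2 * n := by
    rw [(monic_paramDenom d).natDegree_pow, natDegree_paramDenom]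
    omega
  refine isMomentFunctional_of_parametrization (ν := ν) (measurableSet_curve6 a d e)
    (Φ := fun x => param a d e ((x : ℂ).re / (x : ℂ).im))
    (w := fun x => (homogEval (2 * n) (paramDenom d ^ m) x).toNNReal)
    (measurable_param_comp (by fun_prop) a d e) (fun x => param_mem_curve6 hd _)
    (by fun_prop) fun p => ?_
  set q := numerator hd m ⟨restr (curve6 a d e) p, restr_mem p.2⟩
  have hq : (fun x => homogEval (2 * n) q x) =ᵐ[ν]
      fun x => (homogEval (2 * n) (paramDenom d ^ m) x).toNNReal •
        eval (param a d e ((x : ℂ).re / (x : ℂ).im)) (p : MvPolynomial (Fin 2) ℝ) := by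
    filter_upwards [hν] with x hx
    have ht := sq_sub_pos hd ((x : ℂ).re / (x : ℂ).im)
    have hqt := isNumerator_numerator hd ⟨restr (curve6 a d e) p, restr_mem p.2⟩ _
      (param_mem_curve6 hd ((x : ℂ).re / (x : ℂ).im))
    rw [evalAt_restr] at hqt
    change _ = q.eval ((x : ℂ).re / (x : ℂ).im) at hqt
    rw [homogEval_of_im_ne_zero ((natDegree_numerator_le hd _).trans hmn) hx,
      homogEval_of_im_ne_zero hdeg hx, Polynomial.eval_pow, eval_paramDenom, NNReal.smul_def,
      Real.coe_toNNReal _ (by rw [pow_mul _ 2]; positivity), ← hqt, smul_eq_mul]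
    change _ * (((x : ℂ).re / (x : ℂ).im) ^ 2 - d) ^ m * _ = _
    ring
  exact ⟨(integrable_continuousMap ν _).congr hq, (hL p).trans (integral_congr_ae hq)⟩

end MomentFunctional

section Isotropic

theorem mul_pole_pow_mem_span (hd : d < 0) {z ω : ℂ} (n i : ℕ)
    (hz : z ∈ (ℝ ∙ ω * pole d ^ n)) : z * pole d ^ i ∈ (ℝ ∙ ω * pole d ^ ((n + i) % 2)) := by
  obtain ⟨r, rfl⟩ := Submodule.mem_span_singleton.1 hz
  refine Submodule.mem_span_singleton.2 ⟨r * d ^ ((n + i) / 2), ?_⟩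
  have hpow : pole d ^ n * pole d ^ i = pole d ^ ((n + i) % 2) * d ^ ((n + i) / 2) := by
    rw [← pole_sq hd, ← pow_mul, ← pow_add, ← pow_add, Nat.mod_add_div]
  simp only [Complex.real_smul, Complex.ofReal_mul, Complex.ofReal_pow]
  linear_combination -(r * ω) * hpow

theorem exists_notMem_twistedHyperplane (hd : d < 0) (hω : poleValue a d e ≠ 0) (hk : 1 ≤ k)
    {g : CoordRing (curve6 a d e)} (hg : g ∈ twistedSpan a d e k ε) (hg0 : g ≠ 0) :
    ∃ δ, ∃ h ∈ twistedSpan a d e k δ, h ∉ twistedHyperplane a d e k δ ∧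
      ∀ v (hv : v ∈ curve6 a d e), evalAt v hv g = 0 → evalAt v hv h = 0 := by
  obtain ⟨q, hq, hqω, hgq⟩ := twistedSpan_le_numeratorSpace hd hk hg
  have hq0 : q ≠ 0 := fun h => hg0 (hgq.eq hd (h ▸ IsNumerator.zero))
  obtain ⟨i, hi⟩ := Nat.exists_eq_add_of_le hq
  have hdeg : (q * Polynomial.X ^ i).natDegree ≤ 3 * k := by
    rw [Polynomial.natDegree_mul_X_pow i hq0, hi]
  have hcoeff : (q * Polynomial.X ^ i).coeff (3 * k) ≠ 0 := by
    rw [hi, Polynomial.coeff_mul_X_pow]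
    exact Polynomial.leadingCoeff_ne_zero.2 hq0
  obtain ⟨h, hh, hhq⟩ := exists_isNumerator_twistedSpan
    (ε := ⟨(ε + i) % 2, Nat.mod_lt _ two_pos⟩) hd hω hk hdeg (by
      rw [map_mul, map_pow, Polynomial.aeval_X]
      exact mul_pole_pow_mem_span hd ε i hqω)
  refine ⟨_, h, hh, fun hmem => hcoeff ((mem_twistedHyperplane_iff hd hk hh hhq).1 hmem),
    fun v hv hgv => ?_⟩
  have hqv : q.eval (v 1) = 0 := by rw [← hgq v hv, hgv, zero_mul]
  have hhv := hhq v hv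
  rw [Polynomial.eval_mul, hqv, zero_mul] at hhv
  exact (mul_eq_zero.1 hhv).resolve_right (pow_ne_zero _ (sq_sub_pos hd _).ne')

end Isotropic

section Induced

variable {C : Set (Fin 2 → ℝ)} {m : ℕ} {L : PolyLE m →ₗ[ℝ] ℝ}

theorem eval_lift (f : CoordLE C m) {v : Fin 2 → ℝ} (hv : v ∈ C) :
    eval v (lift f : MvPolynomial (Fin 2) ℝ) = evalAt v hv (f : CoordRing C) := by
  rw [← restr_lift f, evalAt_restr]

theorem IsMomentFunctional.induced_nonneg (hM : IsMomentFunctional C L) (hC : MeasurableSet C)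
    (h : Descends C L) {f : CoordLE C m}
    (hf : ∀ v (hv : v ∈ C), 0 ≤ evalAt v hv (f : CoordRing C)) : 0 ≤ induced L h f := by
  obtain ⟨μ, -, hμ⟩ := hM
  change 0 ≤ L (lift f)
  rw [(hμ _).2]
  exact setIntegral_nonneg hC fun v hv => eval_lift f hv ▸ hf v hv

theorem IsMomentFunctional.induced_eq_zero (hM : IsMomentFunctional C L) (hC : MeasurableSet C)
    (h : Descends C L) {f g : CoordLE C m}
    (hf : ∀ v (hv : v ∈ C), 0 ≤ evalAt v hv (f : CoordRing C))
    (hfg : ∀ v (hv : v ∈ C), evalAt v hv (f : CoordRing C) = 0 → evalAt v hv (g : CoordRing C) = 0)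
    (hf0 : induced L h f = 0) : induced L h g = 0 := by
  obtain ⟨μ, -, hμ⟩ := hM
  have hpos : ∀ᵐ v ∂μ.restrict C, 0 ≤ eval v (lift f : MvPolynomial (Fin 2) ℝ) := by
    filter_upwards [ae_restrict_mem hC] with v hv
    exact eval_lift f hv ▸ hf v hv
  change L (lift f) = 0 at hf0
  rw [(hμ _).2, setIntegral_eq_zero_iff_of_nonneg_ae hpos (hμ _).1.integrableOn] at hf0
  refine (hμ (lift g)).2.trans (integral_eq_zero_of_ae ?_)
  filter_upwards [hf0, ae_restrict_mem hC] with v hfv hv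
  rw [eval_lift f hv] at hfv
  exact (eval_lift g hv).trans (hfg v hv hfv)

end Induced

section Forms

variable {C : Set (Fin 2 → ℝ)} {V : Submodule ℝ (TotalFrac C)}
  (Λ : CoordRing C →ₗ[ℝ] ℝ)

theorem coordForm_isSymm (LC : CoordLE C (2 * k) →ₗ[ℝ] ℝ) : (coordForm (k := k) LC).IsSymm :=
  ⟨fun f g => congrArg LC (Subtype.ext (mul_comm (f : CoordRing C) g))⟩

theorem coordForm_apply (f g : CoordLE C k) :
    coordForm (Λ.domRestrict (CoordLE C (2 * k))) f g = Λ (f * g) := rfl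

theorem locForm_isSymm {f : TotalFrac C} (LC : CoordLE C (2 * k) →ₗ[ℝ] ℝ)
    (hV : Admissible k V f) : (locForm LC hV).IsSymm := by
  refine ⟨fun g h => ?_⟩
  obtain ⟨r, hr, hrgh⟩ := hV g g.2 h h.2
  rw [locForm_apply LC hV g h ⟨r, hr⟩ hrgh,
    locForm_apply LC hV h g ⟨r, hr⟩ (mul_comm (g : TotalFrac C) h ▸ hrgh)]

theorem locForm_toFrac (hV : Admissible k V 1) {g h : CoordRing C} (hg : toFrac C g ∈ V)
    (hh : toFrac C h ∈ V) :
    locForm (Λ.domRestrict (CoordLE C (2 * k))) hV ⟨_, hg⟩ ⟨_, hh⟩ = Λ (g * h) := by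
  obtain ⟨r, hr, hrgh⟩ := hV _ hg _ hh
  rw [locForm_apply _ hV _ _ ⟨r, hr⟩ hrgh, LinearMap.domRestrict_apply]
  exact congrArg Λ (toFrac_injective C (hrgh.trans (by simp)))

end Forms

section Rank

variable (Λ : CoordRing (curve6 a d e) →ₗ[ℝ] ℝ)

theorem Wk_eq_map (a d e : ℝ) (k : ℕ) :
    Wk (curve6 a d e) k = (twistedHyperplane a d e k 1).map (toFrac _) :=
  (Submodule.map_span _ _).symm

theorem toFrac_mem_Vk {g : CoordRing (curve6 a d e)} :
    toFrac _ g ∈ Vk (curve6 a d e) k ↔ g ∈ twistedSpan a d e k 1 := by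
  rw [Vk_eq_map, ← SetLike.mem_coe, Submodule.map_coe, (toFrac_injective _).mem_set_image,
    SetLike.mem_coe]

theorem toFrac_mem_Wk {g : CoordRing (curve6 a d e)} :
    toFrac _ g ∈ Wk (curve6 a d e) k ↔ g ∈ twistedHyperplane a d e k 1 := by
  rw [Wk_eq_map, ← SetLike.mem_coe, Submodule.map_coe, (toFrac_injective _).mem_set_image,
    SetLike.mem_coe]

theorem forall_mem_Vk {p : Vk (curve6 a d e) k → Prop} :
    (∀ g, p g) ↔ ∀ g (hg : g ∈ twistedSpan a d e k 1), p ⟨toFrac _ g, toFrac_mem_Vk.2 hg⟩ := by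
  refine ⟨fun h g hg => h _, fun h ⟨g, hg⟩ => ?_⟩
  obtain ⟨g, hg', rfl⟩ := Vk_eq_map a d e k ▸ hg
  exact h g hg'

theorem exists_mem_Vk {p : Vk (curve6 a d e) k → Prop} :
    (∃ g, p g) ↔ ∃ g, ∃ hg : g ∈ twistedSpan a d e k 1, p ⟨toFrac _ g, toFrac_mem_Vk.2 hg⟩ := by
  simpa using (forall_mem_Vk (p := fun g => ¬ p g)).not

theorem Uk_eq_twistedHyperplane (a d e : ℝ) (k : ℕ) :
    Uk (curve6 a d e) k = twistedHyperplane a d e k 0 := rfl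

theorem Uk_covBy_coordLE (hd : d < 0) (hω : poleValue a d e ≠ 0) (hk : 1 ≤ k) :
    Uk (curve6 a d e) k ⋖ CoordLE (curve6 a d e) k := by
  rw [coordLE_eq_twistedSpan hd hω hk, Uk_eq_twistedHyperplane]
  exact twistedHyperplane_covBy_twistedSpan hd hk

theorem Wk_covBy_Vk (hd : d < 0) (hk : 1 ≤ k) :
    Wk (curve6 a d e) k ⋖ Vk (curve6 a d e) k := by
  have hmon := (toFrac_mem_Wk (g := mon (curve6 a d e) 0 k)).not.2
    (mon_zero_notMem_twistedHyperplane hd hk)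
  rw [Wk, Set.image_sdiff (toFrac_injective _), Set.image_singleton] at hmon ⊢
  exact span_sdiff_covBy_span
    (Set.mem_image_of_mem (toFrac _) (mon_zero_mem_twistedBasis _ k 1)) hmon

theorem finiteDimensional_coordLE (C : Set (Fin 2 → ℝ)) (m : ℕ) :
    FiniteDimensional ℝ (CoordLE C m) := by
  unfold CoordLE
  infer_instance

theorem finiteDimensional_Vk (C : Set (Fin 2 → ℝ)) (k : ℕ) : FiniteDimensional ℝ (Vk C k) := by
  have := finiteDimensional_coordLE C (k + 1)
  have hle : Vk C k ≤ (CoordLE C (k + 1)).map (toFrac C) := by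
    rw [Vk, ← Submodule.map_span]
    refine Submodule.map_mono (Submodule.span_le.2 ?_)
    rintro _ (rfl | ⟨i, _, hik, rfl | rfl⟩ | ⟨j, hj, rfl⟩) <;> exact mon_mem _ (by omega)
  exact Submodule.finiteDimensional_of_le hle

theorem squarePositive_iff (hd : d < 0) (hω : poleValue a d e ≠ 0) (hk : 1 ≤ k) :
    SquarePositive (k := k) (Λ.domRestrict (CoordLE (curve6 a d e) (2 * k))) ↔
      ∀ g ∈ twistedSpan a d e k 0, 0 ≤ Λ (g * g) := by
  rw [← coordLE_eq_twistedSpan hd hω hk]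
  exact Subtype.forall

theorem locSquarePositive_iff (hk : 1 ≤ k) :
    LocSquarePositive (Λ.domRestrict (CoordLE (curve6 a d e) (2 * k))) (admissible_Vk a d e hk) ↔
      ∀ g ∈ twistedSpan a d e k 1, 0 ≤ Λ (g * g) := by
  simp only [LocSquarePositive, forall_mem_Vk, locForm_toFrac]

theorem rank_coordForm_eq_iff (hd : d < 0) (hω : poleValue a d e ≠ 0) (hk : 1 ≤ k)
    (hΛ : ∀ g ∈ twistedSpan a d e k 0, 0 ≤ Λ (g * g)) :
    LinearMap.rank (coordForm (k := k) (Λ.domRestrict (CoordLE (curve6 a d e) (2 * k)))) =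
        rankOn (coordForm (Λ.domRestrict (CoordLE (curve6 a d e) (2 * k))))
          (Uk (curve6 a d e) k) ↔
      ∃ g ∈ twistedSpan a d e k 0, g ∉ twistedHyperplane a d e k 0 ∧ Λ (g * g) = 0 := by
  have := finiteDimensional_coordLE (curve6 a d e) k
  rw [rank_eq_rankOn_iff (coordForm_isSymm _) ((squarePositive_iff Λ hd hω hk).2 hΛ)
    (Uk_covBy_coordLE hd hω hk), ← coordLE_eq_twistedSpan hd hω hk, Subtype.exists]
  simp only [Uk_eq_twistedHyperplane, coordForm_apply, exists_prop]

theorem rank_locForm_eq_iff (hd : d < 0) (hk : 1 ≤ k)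
    (hΛ : ∀ g ∈ twistedSpan a d e k 1, 0 ≤ Λ (g * g)) :
    LinearMap.rank (locForm (Λ.domRestrict (CoordLE (curve6 a d e) (2 * k)))
        (admissible_Vk a d e hk)) =
        rankOn (locForm (Λ.domRestrict (CoordLE (curve6 a d e) (2 * k)))
          (admissible_Vk a d e hk)) (Wk (curve6 a d e) k) ↔
      ∃ g ∈ twistedSpan a d e k 1, g ∉ twistedHyperplane a d e k 1 ∧ Λ (g * g) = 0 := by
  have := finiteDimensional_Vk (curve6 a d e) k
  rw [rank_eq_rankOn_iff (locForm_isSymm _ _) ((locSquarePositive_iff Λ hk).2 hΛ)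
    (Wk_covBy_Vk hd hk), exists_mem_Vk]
  simp only [toFrac_mem_Wk, locForm_toFrac, exists_prop]

end Rank

section Singular

variable {L : PolyLE (2 * k) →ₗ[ℝ] ℝ} {Λ : CoordRing (curve6 a d e) →ₗ[ℝ] ℝ}

theorem Singular.exists_mul_self_eq_zero (hd : d < 0) (hω : poleValue a d e ≠ 0) (hk : 1 ≤ k)
    (hL : Singular L (admissible_Vk a d e hk))
    (hΛ : Λ.domRestrict (CoordLE (curve6 a d e) (2 * k)) = induced L hL.descends) :
    ∃ ε, ∃ g ∈ twistedSpan a d e k ε, g ≠ 0 ∧ Λ (g * g) = 0 := by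
  obtain ⟨h, hns⟩ := hL
  rw [Nonsingular, not_and_or] at hns
  rcases hns with hns | hns
  · push Not at hns
    obtain ⟨p, ⟨hp, hpI⟩ | ⟨hp, hpI⟩⟩ := hns
    · refine ⟨0, restr _ (p : MvPolynomial (Fin 2) ℝ),
        coordLE_eq_twistedSpan hd hω hk ▸ restr_mem p.2,
        fun h0 => hpI (Ideal.Quotient.eq_zero_iff_mem.1 h0), ?_⟩
      have hpp := (LinearMap.congr_fun hΛ _).trans
        (induced_apply L h ⟨_, polyLE_mul_mem p.2 p.2⟩)
      exact hpp.trans (LinearMap.congr_fun (LinearMap.mem_ker.1 hp) p)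
    · refine absurd ?_ hp
      rw [LinearMap.mem_ker]
      ext q
      exact h _ (Ideal.mul_mem_right _ _ hpI)
  · obtain ⟨g, hgV, hg, hg0⟩ := exists_mem_Vk.1 (Submodule.exists_mem_ne_zero_of_ne_bot hns)
    refine ⟨1, g, hgV, fun h0 => hg0 (Subtype.ext (by simp [h0])), ?_⟩
    rw [← locForm_toFrac Λ (admissible_Vk a d e hk) (toFrac_mem_Vk.2 hgV) (toFrac_mem_Vk.2 hgV), hΛ]
    exact LinearMap.congr_fun (LinearMap.mem_ker.1 hg) _

theorem isMomentFunctional_of_mul_self_eq_zero (hd : d < 0) (hω : poleValue a d e ≠ 0)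
    (hk : 1 ≤ k) (h : Descends (curve6 a d e) L)
    (hΛ : Λ.domRestrict (CoordLE (curve6 a d e) (2 * k)) = induced L h)
    (hpos : ∀ ε, ∀ g ∈ twistedSpan a d e k ε, 0 ≤ Λ (g * g)) {g : CoordRing (curve6 a d e)}
    (hg : g ∈ twistedSpan a d e k ε) (hgU : g ∉ twistedHyperplane a d e k ε)
    (hg0 : Λ (g * g) = 0) : IsMomentFunctional (curve6 a d e) L := by
  obtain ⟨ν, _, hν⟩ := exists_measure_circle hd hω hk Λ hpos
  obtain ⟨q, hq, -, hgq⟩ := twistedSpan_le_numeratorSpace hd hk hg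
  have hgg : numerator hd (2 * k) ⟨g * g, mul_self_mem_coordLE hd hω hk hg⟩ = q * q :=
    (isNumerator_numerator hd _).unique hd hgq.mul_self
  have hν0 := hν ⟨g * g, mul_self_mem_coordLE hd hω hk hg⟩
  rw [hg0, hgg] at hν0
  refine isMomentFunctional_of_measure_circle hd (n := 3 * k) (by omega)
    (ae_im_ne_zero_of_integral_eq_zero hq ((mem_twistedHyperplane_iff hd hk hg hgq).not.1 hgU)
      hν0.symm) fun p => ?_
  rw [← hν, ← induced_apply L h p, ← hΛ]
  rfl

theorem isMomentFunctional_iff (hd : d < 0) (hω : poleValue a d e ≠ 0) (hk : 1 ≤ k)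
    (hL : Singular L (admissible_Vk a d e hk))
    (hΛ : Λ.domRestrict (CoordLE (curve6 a d e) (2 * k)) = induced L hL.descends) :
    IsMomentFunctional (curve6 a d e) L ↔
      (∀ ε, ∀ g ∈ twistedSpan a d e k ε, 0 ≤ Λ (g * g)) ∧
      ∃ ε, ∃ g ∈ twistedSpan a d e k ε, g ∉ twistedHyperplane a d e k ε ∧ Λ (g * g) = 0 := by
  have hΛi (f : CoordLE (curve6 a d e) (2 * k)) : Λ f = induced L hL.descends f :=
    LinearMap.congr_fun hΛ f
  constructor
  · intro hM
    have hsq (f : CoordRing (curve6 a d e)) (v) (hv : v ∈ curve6 a d e) :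
        0 ≤ evalAt v hv (f * f) := by
      rw [map_mul]
      exact mul_self_nonneg _
    refine ⟨fun ε g hg => ?_, ?_⟩
    · exact (hM.induced_nonneg (measurableSet_curve6 a d e) hL.descends
        (f := ⟨_, mul_self_mem_coordLE hd hω hk hg⟩) (hsq g)).trans_eq (hΛi _).symm
    · obtain ⟨ε, g, hg, hg0, hΛg⟩ := hL.exists_mul_self_eq_zero hd hω hk hΛ
      obtain ⟨δ, h, hh, hhU, hgh⟩ := exists_notMem_twistedHyperplane hd hω hk hg hg0
      refine ⟨δ, h, hh, hhU, (hΛi ⟨_, mul_self_mem_coordLE hd hω hk hh⟩).trans ?_⟩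
      refine hM.induced_eq_zero (measurableSet_curve6 a d e) hL.descends
        (f := ⟨_, mul_self_mem_coordLE hd hω hk hg⟩) (hsq g) (fun v hv hgv => ?_)
        ((hΛi _).symm.trans hΛg)
      rw [map_mul, mul_self_eq_zero] at hgv ⊢
      exact hgh v hv hgv
  · rintro ⟨hpos, ε, g, hg, hgU, hg0⟩
    exact isMomentFunctional_of_mul_self_eq_zero hd hω hk hL.descends hΛ hpos hg hgU hg0

end Singular

end CubicTMP

end

theorem theorem4p4 (a d e : ℝ) (hd : d < 0) (hP : Irreducible (P6 a d e))
    (k : ℕ) (hk : 1 ≤ k) (L : PolyLE (2 * k) →ₗ[ℝ] ℝ)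
    (hL : Singular L (admissible_Vk a d e hk)) :
    IsMomentFunctional (curve6 a d e) L ↔
      SquarePositive (induced L hL.descends) ∧
      LocSquarePositive (induced L hL.descends) (admissible_Vk a d e hk) ∧
      (LinearMap.rank (coordForm (induced L hL.descends)) =
          rankOn (coordForm (induced L hL.descends)) (Uk (curve6 a d e) k) ∨
        LinearMap.rank (locForm (induced L hL.descends) (admissible_Vk a d e hk)) =
          rankOn (locForm (induced L hL.descends) (admissible_Vk a d e hk))
            (Wk (curve6 a d e) k)) := by
  have hω := poleValue_ne_zero hd hP
  obtain ⟨Λ, hΛ⟩ : ∃ Λ : CoordRing (curve6 a d e) →ₗ[ℝ] ℝ,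
      Λ.domRestrict (CoordLE (curve6 a d e) (2 * k)) = induced L hL.descends :=
    LinearMap.exists_extend _
  rw [isMomentFunctional_iff hd hω hk hL hΛ, Fin.forall_fin_two, Fin.exists_fin_two, and_assoc,
    ← hΛ, squarePositive_iff Λ hd hω hk, locSquarePositive_iff Λ hk]
  exact and_congr_right fun hs => and_congr_right fun hl =>
    (or_congr (rank_coordForm_eq_iff Λ hd hω hk hs) (rank_locForm_eq_iff Λ hd hk hl)).symm
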